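/- **Theorem (Matrix recovery with prior knowledge).** There is a universal constant $C>0$ with the following property. Let $n,m,r$ be integers with $r\ge 1$, let $M\in\mathbb{R}^{n\times n}$, and let $M_r=U_r\Sigma_rV_r^*$ be a rank-$r$ truncation of $M$, obtained from an SVD $M=U\Sigma V^*$ (singular values in non-increasing order, ties broken arbitrarily) by keeping the $r$ largest singular values; put $M_{r^+}=M-M_r$. Let $\mathrm{U}_r=\mathrm{span}(M_r)$ and $\mathrm{V}_r=\mathrm{span}(M_r^*)$ be the column and row spaces of $M_r$, let $\widetilde{\mathrm U}_r,\widetilde{\mathrm V}_r\subseteq\mathbb{R}^n$ be $r$-dimensional subspaces (the prior knowledge), and let $u=\angle[\mathrm U_r,\widetilde{\mathrm U}_r]$ and $v=\angle[\mathrm V_r,\widetilde{\mathrm V}_r]$ be the largest principal angles; here $\angle[\mathrm A,\mathrm B]=\max_{a\in \mathrm A,\|a\|_2=1}\,\min_{b\in \mathrm B,\|b\|_2=1}\angle(a,b)$ (and $0$ if $\mathrm A=0$). For weights $\lambda,\rho\in(0,1]$ set $$Q_{\widetilde{\mathrm U}_r,\lambda}=\lambda P_{\widetilde{\mathrm U}_r}+P_{\widetilde{\mathrm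 U}_r^\perp},\qquad Q_{\widetilde{\mathrm V}_r,\rho}=\rho P_{\widetilde{\mathrm V}_r}+P_{\widetilde{\mathrm V}_r^\perp},$$ where $P_{\mathrm W}$ is the orthogonal projection onto $\mathrm W$, and $$\alpha_1=\sqrt{\frac{\lambda^4\cos^2u+\sin^2u}{\lambda^2\cos^2u+\sin^2u}}+\sqrt{\frac{\rho^4\cos^2v+\sin^2v}{\rho^2\cos^2v+\sin^2v}},\qquad \alpha_2=\sqrt{\frac{2(1-\lambda^2)\sin^2u}{\lambda^2\cos^2u+\sin^2u}}+\sqrt{\frac{2(1-\rho^2)\sin^2v}{\rho^2\cos^2v+\sin^2v}}.$$ Let $\mathcal R_m:\mathbb{R}^{n\times n}\to\mathbb{R}^m$ be a linear operator satisfying the $\delta_{32r}$-RIP, that is, $\delta_{32r}\in[0,1)$ and $(1-\delta_{32r})\|X\|_F\le\|\mathcal R_m(X)\|_2\le(1+\delta_{32r})\|X\|_F$ for every $X\in\mathbb{R}^{n\times n}$ with $\mathrm{rank}(X)\le 32r$, and suppose that $$\delta_{32r}\le\frac{0.9-\max[\alpha_1,\alpha_2]/\sqrt{30}}{0.9+\max[\alpha_1,\alpha_2]/\sqrt{30}}.$$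 Let $y=\mathcal R_m(M+E)$ with $E\in\mathbb{R}^{n\times n}$ and $\|\mathcal R_m(E)\|_2\le e$. Then every solution $\widehat M$ of $$\min_X\ \bigl\|Q_{\widetilde{\mathrm U}_r,\lambda}\,X\,Q_{\widetilde{\mathrm V}_r,\rho}\bigr\|_*\quad\text{subject to}\quad\|\mathcal R_m(X)-y\|_2\le e$$ satisfies $$\|\widehat M-M\|_F\le\frac{C}{1-\delta_{32r}}\left(\frac{\|M_{r^+}\|_*}{\sqrt r}+e\right).$$ Here $\|\cdot\|_*$ is the nuclear norm (sum of the singular values) and $\|\cdot\|_F$ the Frobenius norm. -/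

import Mathlib

/-! Matrices carry the Frobenius norm; vectors live in `EuclideanSpace` with the `ℓ²` norm. -/
open scoped Matrix.Norms.Frobenius

noncomputable section

namespace MatrixRecovery

/-- The nuclear norm: the sum of the singular values. -/
def nuclearNorm {n : ℕ} (X : Matrix (Fin n) (Fin n) ℝ) : ℝ :=
  ∑ i ∈ Finset.range n, (Matrix.toEuclideanLin X).singularValues i

/-- `Mr` is a rank-`r` truncation of `M`: for some singular value decomposition `M = U Σ Vᵀ` with
non-increasing singular values, `Mr` keeps the first `r` of them (and the corresponding singular
vectors). Ties are broken arbitrarily. -/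
def IsRankTruncation {n : ℕ} (r : ℕ) (M Mr : Matrix (Fin n) (Fin n) ℝ) : Prop :=
  ∃ U ∈ Matrix.orthogonalGroup (Fin n) ℝ, ∃ V ∈ Matrix.orthogonalGroup (Fin n) ℝ,
    ∃ σ : Fin n → ℝ, Antitone σ ∧ (∀ i, 0 ≤ σ i) ∧
      M = U * Matrix.diagonal σ * V.transpose ∧
      Mr = U * Matrix.diagonal (fun i : Fin n => if (i : ℕ) < r then σ i else 0) * V.transpose

/-- The column space (span) of a matrix. -/
def columnSpace {n : ℕ} (X : Matrix (Fin n) (Fin n) ℝ) :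
    Submodule ℝ (EuclideanSpace ℝ (Fin n)) :=
  LinearMap.range (Matrix.toEuclideanLin X)

/-- The row space of a matrix, i.e. the column space of its transpose. -/
def rowSpace {n : ℕ} (X : Matrix (Fin n) (Fin n) ℝ) :
    Submodule ℝ (EuclideanSpace ℝ (Fin n)) :=
  columnSpace X.transpose

/-- The largest principal angle between `U` and `W`, for `dim U ≤ dim W`, `W ≠ 0`: the largest angle
that a unit vector of `U` makes with `W`, the angle between a vector and `W` being the smallest angle
it makes with a unit vector of `W`. It is `0` for `U = 0`. -/
def largestPrincipalAngle {n : ℕ} (U W : Submodule ℝ (EuclideanSpace ℝ (Fin n))) : ℝ :=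
  ⨆ x : {x : EuclideanSpace ℝ (Fin n) // x ∈ U ∧ ‖x‖ = 1},
    ⨅ y : {y : EuclideanSpace ℝ (Fin n) // y ∈ W ∧ ‖y‖ = 1},
      InnerProductGeometry.angle x.1 y.1

/-- The matrix of the orthogonal projection onto the subspace `W`. -/
def projMatrix {n : ℕ} (W : Submodule ℝ (EuclideanSpace ℝ (Fin n))) :
    Matrix (Fin n) (Fin n) ℝ :=
  Matrix.toEuclideanLin.symm (W.starProjection : EuclideanSpace ℝ (Fin n) →ₗ[ℝ] _)

/-- The weight matrix `Q = w · P_W + P_{W^⊥}`. -/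
def weightMatrix {n : ℕ} (W : Submodule ℝ (EuclideanSpace ℝ (Fin n))) (w : ℝ) :
    Matrix (Fin n) (Fin n) ℝ :=
  w • projMatrix W + projMatrix Wᗮ

/-- The `(s, δ)`-restricted isometry property of a linear measurement operator. -/
def RIP {n m : ℕ} (R : Matrix (Fin n) (Fin n) ℝ →ₗ[ℝ] EuclideanSpace ℝ (Fin m))
    (s : ℕ) (δ : ℝ) : Prop :=
  0 ≤ δ ∧ δ < 1 ∧ ∀ X : Matrix (Fin n) (Fin n) ℝ, X.rank ≤ s →
    (1 - δ) * ‖X‖ ≤ ‖R X‖ ∧ ‖R X‖ ≤ (1 + δ) * ‖X‖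

/-- The feasible set `{X : ‖R(X) - y‖₂ ≤ e}`. -/
def feasibleSet {n m : ℕ} (R : Matrix (Fin n) (Fin n) ℝ →ₗ[ℝ] EuclideanSpace ℝ (Fin m))
    (y : EuclideanSpace ℝ (Fin m)) (e : ℝ) : Set (Matrix (Fin n) (Fin n) ℝ) :=
  {X | ‖R X - y‖ ≤ e}

/-- `Mhat` solves the weighted nuclear-norm program: it minimizes `‖Q_{U,lam} X Q_{V,rho}‖_*`
over all `X` with `‖R(X) - y‖₂ ≤ e`. -/
def IsSolution {n m : ℕ} (R : Matrix (Fin n) (Fin n) ℝ →ₗ[ℝ] EuclideanSpace ℝ (Fin m))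
    (y : EuclideanSpace ℝ (Fin m)) (e : ℝ) (U V : Submodule ℝ (EuclideanSpace ℝ (Fin n)))
    (lam rho : ℝ) (Mhat : Matrix (Fin n) (Fin n) ℝ) : Prop :=
  Mhat ∈ feasibleSet R y e ∧
    IsMinOn (fun X => nuclearNorm (weightMatrix U lam * X * weightMatrix V rho))
      (feasibleSet R y e) Mhat

/-- The factor `α₁`. -/
def alpha1 (lam rho u v : ℝ) : ℝ :=
  √((lam ^ 4 * Real.cos u ^ 2 + Real.sin u ^ 2) / (lam ^ 2 * Real.cos u ^ 2 + Real.sin u ^ 2)) +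
  √((rho ^ 4 * Real.cos v ^ 2 + Real.sin v ^ 2) / (rho ^ 2 * Real.cos v ^ 2 + Real.sin v ^ 2))

/-- The factor `α₂`. -/
def alpha2 (lam rho u v : ℝ) : ℝ :=
  √(2 * (1 - lam ^ 2) * Real.sin u ^ 2 / (lam ^ 2 * Real.cos u ^ 2 + Real.sin u ^ 2)) +
  √(2 * (1 - rho ^ 2) * Real.sin v ^ 2 / (rho ^ 2 * Real.cos v ^ 2 + Real.sin v ^ 2))

/-- The upper bound `(0.9 - α/√30) / (0.9 + α/√30)` on the isometry constant, `α = max(α₁, α₂)`. -/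
def deltaBound (α : ℝ) : ℝ := (0.9 - α / √30) / (0.9 + α / √30)

end MatrixRecovery

end

/-! Let `H` be the error and let `P`, `P'` project onto `r`-dimensional spaces containing the column
and row space of `Mr`. As for unweighted nuclear norm minimization, one shows that the part `H₂₂ =
(1 - P) H (1 - P')` of the error has nuclear norm at most a multiple of `√r` times the Frobenius
norm of a part of `H` of rank at most `32 r`, up to a multiple of `‖M - Mr‖_*`; then the restricted
isometry property controls that part.

Nuclear norm. All facts needed come from the duality `‖X‖_* = max {tr (Zᵀ X) : ‖Z‖ ≤ 1}`
(`trace_transpose_mul_le`, `exists_trace_transpose_mul_eq`): the triangle inequality, contraction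
under multiplication, and the pinching inequality `nuclearNorm_pinching`.

Weights. If `S` projects onto `Q U`, then `Q` is block upper triangular from `U ⊕ Uᗮ` to `Q U ⊕ (Q
U)ᗮ`. Hence `Q Mr Q'` lives in the first diagonal block, and pinching turns optimality into `‖W₂₂‖_*
≤ ‖W₁₁‖_* + 2 ‖M - Mr‖_*` for the diagonal blocks of `W = Q H Q'` (`nuclearNorm_last_block_le`). The
block `W₁₁` has rank at most `r`, and its size is governed by the norms of the first block rows of
the two weights, bounded by the two summands `a`, `b` of `α₁`. The Gram matrix of the last block of
`Q` differs from the identity of `Uᗮ` by a matrix `G` of rank at most `r` with `0 ≤ G ≤ x²`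
(`exists_isWeightBlock`), so `H₂₂` differs from a contraction of `W₂₂` by two terms of rank at most
`r` (`nuclearNorm_offTangent_le`). With `y` the analogue of `x` for the row space, `√2 (x + y) =
α₂`.

Tail. The part `H₂₂` is cut along its singular values into blocks of rank at most `30 r`
(`exists_block_decomposition`). The tail, all blocks but the first, enters the terms above only
after they are cut down to rank `r`, so its operator norm, which is at most `‖H₂₂‖_* / (30 r)`,
makes it contribute a small multiple of `‖H₂₂‖_*`. The resulting constant is at most `1.1 max α₁ α₂`
(`mul_add_gap_le`), and the bound on the isometry constant leaves just enough room for the factor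
`1.1`, as `1.1 * 0.9 < 1`. -/

noncomputable section

namespace MatrixRecovery

open Matrix

variable {n : ℕ}

/-! ### The operator norm and the Frobenius norm -/

/-- The `ℓ² → ℓ²` operator norm of a square matrix. -/
def opNorm (A : Matrix (Fin n) (Fin n) ℝ) : ℝ :=
  ‖toEuclideanCLM (n := Fin n) (𝕜 := ℝ) A‖

lemma opNorm_nonneg (A : Matrix (Fin n) (Fin n) ℝ) : 0 ≤ opNorm A := norm_nonneg _

lemma opNorm_mul_le (A B : Matrix (Fin n) (Fin n) ℝ) : opNorm (A * B) ≤ opNorm A * opNorm B := by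
  unfold opNorm
  rw [map_mul]
  exact norm_mul_le _ _

lemma opNorm_neg (A : Matrix (Fin n) (Fin n) ℝ) : opNorm (-A) = opNorm A := by
  unfold opNorm
  rw [map_neg, norm_neg]

lemma opNorm_transpose (A : Matrix (Fin n) (Fin n) ℝ) : opNorm Aᵀ = opNorm A := by
  unfold opNorm
  rw [← conjTranspose_eq_transpose_of_trivial, ← star_eq_conjTranspose, map_star]
  exact norm_star (toEuclideanCLM (n := Fin n) (𝕜 := ℝ) A)

lemma opNorm_le_iff {A : Matrix (Fin n) (Fin n) ℝ} {c : ℝ} (hc : 0 ≤ c) :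
    opNorm A ≤ c ↔ ∀ x, ‖toEuclideanLin A x‖ ≤ c * ‖x‖ :=
  ContinuousLinearMap.opNorm_le_iff hc

lemma toEuclideanLin_mul_apply (A B : Matrix (Fin n) (Fin n) ℝ) (x : EuclideanSpace ℝ (Fin n)) :
    toEuclideanLin (A * B) x = toEuclideanLin A (toEuclideanLin B x) := by
  simp [toEuclideanLin]

lemma inner_toEuclideanLin_left (A : Matrix (Fin n) (Fin n) ℝ) (x y : EuclideanSpace ℝ (Fin n)) :
    inner ℝ (toEuclideanLin A x) y = inner ℝ x (toEuclideanLin Aᵀ y) := by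
  rw [← conjTranspose_eq_transpose_of_trivial, toEuclideanLin_conjTranspose_eq_adjoint,
    LinearMap.adjoint_inner_right]

lemma norm_toEuclideanLin_le (A : Matrix (Fin n) (Fin n) ℝ) (x : EuclideanSpace ℝ (Fin n)) :
    ‖toEuclideanLin A x‖ ≤ opNorm A * ‖x‖ :=
  (toEuclideanCLM (n := Fin n) (𝕜 := ℝ) A).le_opNorm x

lemma opNorm_le_one_of_transpose_mul_self {V : Matrix (Fin n) (Fin n) ℝ} (hV : Vᵀ * V = 1) :
    opNorm V ≤ 1 := by
  have h : opNorm V * opNorm V = opNorm (Vᵀ * V) := by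
    unfold opNorm
    rw [← conjTranspose_eq_transpose_of_trivial, ← star_eq_conjTranspose, map_mul, map_star]
    exact (CStarRing.norm_star_mul_self (x := toEuclideanCLM (n := Fin n) (𝕜 := ℝ) V)).symm
  have h1 : opNorm (1 : Matrix (Fin n) (Fin n) ℝ) ≤ 1 := by
    rw [opNorm_le_iff zero_le_one]
    intro x
    simp [toEuclideanLin]
  rw [hV] at h
  nlinarith [opNorm_nonneg V]

lemma opNorm_diagonal_le {d : Fin n → ℝ} {c : ℝ} (hc : 0 ≤ c) (hd : ∀ i, |d i| ≤ c) :
    opNorm (diagonal d) ≤ c := by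
  have h : opNorm (diagonal d) = ‖d‖ := l2_opNorm_diagonal (𝕜 := ℝ) d
  rw [h]
  exact (pi_norm_le_iff_of_nonneg hc).2 hd

lemma norm_sq_eq_trace (X : Matrix (Fin n) (Fin n) ℝ) : ‖X‖ ^ 2 = trace (Xᵀ * X) := by
  rw [frobenius_norm_def, ← Real.sqrt_eq_rpow, Real.sq_sqrt (by positivity), trace,
    Finset.sum_comm]
  simp [mul_apply, pow_two]

lemma norm_sq_eq_sum_col (X : Matrix (Fin n) (Fin n) ℝ) :
    ‖X‖ ^ 2 = ∑ j, ‖WithLp.toLp 2 (X.col j)‖ ^ 2 := by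
  rw [frobenius_norm_def, ← Real.sqrt_eq_rpow, Real.sq_sqrt (by positivity), Finset.sum_comm]
  simp [EuclideanSpace.norm_sq_eq]

lemma norm_mul_le_opNorm_mul (A X : Matrix (Fin n) (Fin n) ℝ) : ‖A * X‖ ≤ opNorm A * ‖X‖ := by
  refine le_of_sq_le_sq ?_ (mul_nonneg (opNorm_nonneg _) (norm_nonneg _))
  rw [mul_pow, norm_sq_eq_sum_col, norm_sq_eq_sum_col, Finset.mul_sum]
  refine Finset.sum_le_sum fun j _ => ?_
  rw [← mul_pow]
  gcongr
  exact norm_toEuclideanLin_le A (WithLp.toLp 2 (X.col j))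

lemma norm_transpose (X : Matrix (Fin n) (Fin n) ℝ) : ‖Xᵀ‖ = ‖X‖ := frobenius_norm_transpose X

lemma norm_mul_le_mul_opNorm (X A : Matrix (Fin n) (Fin n) ℝ) : ‖X * A‖ ≤ ‖X‖ * opNorm A := by
  have h := norm_mul_le_opNorm_mul Aᵀ Xᵀ
  rw [← transpose_mul, norm_transpose, norm_transpose, opNorm_transpose] at h
  linarith

/-! ### Singular values and duality -/

/-- The singular values of a square matrix in non-increasing order, indexed from `0` and continued
by `0`. -/
def sv (X : Matrix (Fin n) (Fin n) ℝ) (i : ℕ) : ℝ := (toEuclideanLin X).singularValues i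

lemma sv_nonneg (X : Matrix (Fin n) (Fin n) ℝ) (i : ℕ) : 0 ≤ sv X i :=
  LinearMap.singularValues_nonneg _ _

lemma sv_antitone (X : Matrix (Fin n) (Fin n) ℝ) : Antitone (sv X) :=
  LinearMap.singularValues_antitone _

lemma sv_of_le (X : Matrix (Fin n) (Fin n) ℝ) {i : ℕ} (hi : n ≤ i) : sv X i = 0 :=
  LinearMap.singularValues_of_finrank_le _ (by simpa using hi)

lemma sv_of_rank_le (X : Matrix (Fin n) (Fin n) ℝ) {i : ℕ} (hi : X.rank ≤ i) : sv X i = 0 := by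
  refine (LinearMap.singularValues_eq_zero_iff_le_finrank_range _).2 ?_
  rwa [rank_eq_finrank_range_toLin X (EuclideanSpace.basisFun (Fin n) ℝ).toBasis
    (EuclideanSpace.basisFun (Fin n) ℝ).toBasis, ← toEuclideanLin_eq_toLin_orthonormal] at hi

lemma nuclearNorm_eq (X : Matrix (Fin n) (Fin n) ℝ) : nuclearNorm X = ∑ i : Fin n, sv X i :=
  Finset.sum_range _

/-- The right half of a singular value decomposition: an orthogonal matrix diagonalizing `Xᵀ X`. -/
lemma exists_orthogonal_diagonalizing (X : Matrix (Fin n) (Fin n) ℝ) :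
    ∃ V : Matrix (Fin n) (Fin n) ℝ, Vᵀ * V = 1 ∧ V * Vᵀ = 1 ∧
      Vᵀ * (Xᵀ * X) * V = diagonal fun i : Fin n => sv X i ^ 2 := by
  have hn : Module.finrank ℝ (EuclideanSpace ℝ (Fin n)) = n := by simp
  set T := toEuclideanLin X with hT
  set b := T.isSymmetric_adjoint_comp_self.eigenvectorBasis hn with hb
  have hortho : ∀ i j, ∑ k, b i k * b j k = if i = j then 1 else 0 := by
    intro i j
    have h := b.inner_eq_ite j i
    simp only [PiLp.inner_apply, RCLike.inner_apply, conj_trivial] at h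
    simpa [eq_comm] using h
  have hV : (of fun i j => b j i : Matrix (Fin n) (Fin n) ℝ)ᵀ * (of fun i j => b j i) = 1 := by
    ext i j
    simp only [mul_apply, transpose_apply, of_apply, hortho, one_apply]
  refine ⟨of fun i j => b j i, hV, mul_eq_one_comm.1 hV, ?_⟩
  have hcol : ∀ i j, (X * of fun i j => b j i) i j = T (b j) i := by
    intro i j
    simp [hT, mul_apply, toEuclideanLin, mulVec, dotProduct]
  have hassoc : ∀ V : Matrix (Fin n) (Fin n) ℝ, Vᵀ * (Xᵀ * X) * V = (X * V)ᵀ * (X * V) := by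
    intro V
    simp only [transpose_mul, Matrix.mul_assoc]
  rw [hassoc]
  ext i j
  have h1 : ((X * of fun i j => b j i)ᵀ * (X * of fun i j => b j i)) i j
      = inner ℝ (T (b j)) (T (b i)) := by
    simp only [mul_apply (M := (X * of fun i j => b j i)ᵀ), transpose_apply, hcol,
      PiLp.inner_apply, RCLike.inner_apply, conj_trivial]
  have h2 : inner ℝ (T (b j)) (T (b i))
      = inner ℝ ((LinearMap.adjoint T ∘ₗ T) (b j)) (b i) := by
    rw [LinearMap.comp_apply, LinearMap.adjoint_inner_left]
  rw [h1, h2, hb, LinearMap.IsSymmetric.apply_eigenvectorBasis, ← hb,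
    ← LinearMap.sq_singularValues_fin, inner_smul_left, b.inner_eq_ite, diagonal_apply]
  by_cases hij : i = j
  · subst hij
    simp [sv, hT]
  · simp [hij, Ne.symm hij]

/-- Upper half of the duality between the nuclear and the operator norm. -/
lemma trace_transpose_mul_le (Z X : Matrix (Fin n) (Fin n) ℝ) :
    trace (Zᵀ * X) ≤ opNorm Z * nuclearNorm X := by
  obtain ⟨V, hV, hV', hX⟩ := exists_orthogonal_diagonalizing X
  have h1 : trace (Zᵀ * X) = trace ((Z * V)ᵀ * (X * V)) := by
    rw [transpose_mul, Matrix.mul_assoc, trace_mul_comm Vᵀ]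
    simp only [Matrix.mul_assoc, hV', Matrix.mul_one]
  have h2 : (X * V)ᵀ * (X * V) = diagonal fun i : Fin n => sv X i ^ 2 := by
    rw [← hX]
    simp only [transpose_mul, Matrix.mul_assoc]
  rw [h1, trace, nuclearNorm_eq, Finset.mul_sum]
  refine Finset.sum_le_sum fun i _ => ?_
  have h3 : ∀ Y : Matrix (Fin n) (Fin n) ℝ,
      ‖WithLp.toLp 2 (Y.col i)‖ ^ 2 = (Yᵀ * Y) i i := by
    intro Y
    rw [EuclideanSpace.norm_sq_eq]
    simp [mul_apply, pow_two]
  have h4 : ‖WithLp.toLp 2 ((X * V).col i)‖ = sv X i := by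
    have := h3 (X * V)
    rw [h2, diagonal_apply_eq] at this
    exact (sq_eq_sq₀ (norm_nonneg _) (sv_nonneg _ _)).1 this
  have h5 : ‖WithLp.toLp 2 ((Z * V).col i)‖ ≤ opNorm Z := by
    have h6 := norm_toEuclideanLin_le Z (WithLp.toLp 2 (V.col i))
    have h7 : ‖WithLp.toLp 2 (V.col i)‖ = 1 := by
      have := h3 V
      rw [hV, one_apply_eq] at this
      nlinarith [norm_nonneg (WithLp.toLp 2 (V.col i))]
    rw [h7, mul_one] at h6
    exact h6
  have h8 : diag ((Z * V)ᵀ * (X * V)) i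
      = inner ℝ (WithLp.toLp 2 ((X * V).col i)) (WithLp.toLp 2 ((Z * V).col i)) := by
    rw [diag_apply, mul_apply (M := (Z * V)ᵀ)]
    simp [PiLp.inner_apply, -transpose_mul]
  rw [h8]
  refine (real_inner_le_norm _ _).trans ?_
  rw [h4, mul_comm]
  exact mul_le_mul_of_nonneg_right h5 (sv_nonneg _ _)

lemma opNorm_mul_diagonal_mul_transpose_le {V : Matrix (Fin n) (Fin n) ℝ} (hV : Vᵀ * V = 1)
    {d : Fin n → ℝ} {c : ℝ} (hc : 0 ≤ c) (hd : ∀ i, |d i| ≤ c) :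
    opNorm (V * diagonal d * Vᵀ) ≤ c := by
  have h1 := opNorm_le_one_of_transpose_mul_self hV
  have h2 := opNorm_diagonal_le hc hd
  calc opNorm (V * diagonal d * Vᵀ) ≤ opNorm V * opNorm (diagonal d) * opNorm Vᵀ :=
        (opNorm_mul_le _ _).trans
          (mul_le_mul_of_nonneg_right (opNorm_mul_le _ _) (opNorm_nonneg _))
    _ ≤ 1 * c * 1 := by
        rw [opNorm_transpose]
        have := opNorm_nonneg V
        have := opNorm_nonneg (diagonal d)
        gcongr
    _ = c := by ring

lemma opNorm_transpose_mul_self (A : Matrix (Fin n) (Fin n) ℝ) :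
    opNorm (Aᵀ * A) = opNorm A ^ 2 := by
  unfold opNorm
  rw [← conjTranspose_eq_transpose_of_trivial, ← star_eq_conjTranspose, map_mul, map_star, pow_two]
  exact CStarRing.norm_star_mul_self (x := toEuclideanCLM (n := Fin n) (𝕜 := ℝ) A)

/-- Lower half of the duality: the partial isometry of the polar decomposition attains the norm. -/
lemma exists_trace_transpose_mul_eq (X : Matrix (Fin n) (Fin n) ℝ) :
    ∃ Z, opNorm Z ≤ 1 ∧ trace (Zᵀ * X) = nuclearNorm X := by
  obtain ⟨V, hV, hV', hX⟩ := exists_orthogonal_diagonalizing X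
  refine ⟨X * V * diagonal (fun i : Fin n => (sv X i)⁻¹) * Vᵀ, ?_, ?_⟩
  · rw [← sq_le_one_iff₀ (opNorm_nonneg _), ← opNorm_transpose_mul_self]
    have h : (X * V * diagonal (fun i : Fin n => (sv X i)⁻¹) * Vᵀ)ᵀ
        * (X * V * diagonal (fun i : Fin n => (sv X i)⁻¹) * Vᵀ)
        = V * diagonal (fun i : Fin n => (sv X i)⁻¹ * sv X i ^ 2 * (sv X i)⁻¹) * Vᵀ := by
      calc _ = V * (diagonal (fun i : Fin n => (sv X i)⁻¹) * (Vᵀ * (Xᵀ * X) * V)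
            * diagonal (fun i : Fin n => (sv X i)⁻¹)) * Vᵀ := by
            simp only [transpose_mul, transpose_transpose, diagonal_transpose, Matrix.mul_assoc]
        _ = _ := by rw [hX, diagonal_mul_diagonal, diagonal_mul_diagonal]
    rw [h]
    refine opNorm_mul_diagonal_mul_transpose_le hV zero_le_one fun i => ?_
    by_cases h0 : sv X i = 0
    · simp [h0]
    · have : (sv X i)⁻¹ * sv X i ^ 2 * (sv X i)⁻¹ = 1 := by field_simp
      simp [this]
  · have h : trace ((X * V * diagonal (fun i : Fin n => (sv X i)⁻¹) * Vᵀ)ᵀ * X)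
        = trace (diagonal (fun i : Fin n => (sv X i)⁻¹) * (Vᵀ * (Xᵀ * X) * V)) := by
      simp only [transpose_mul, transpose_transpose, diagonal_transpose, Matrix.mul_assoc]
      rw [trace_mul_comm]
      simp only [Matrix.mul_assoc]
    rw [h, hX, diagonal_mul_diagonal, trace_diagonal, nuclearNorm_eq]
    refine Finset.sum_congr rfl fun i _ => ?_
    by_cases h0 : sv X i = 0
    · simp [h0]
    · field_simp

lemma nuclearNorm_nonneg (X : Matrix (Fin n) (Fin n) ℝ) : 0 ≤ nuclearNorm X :=
  Finset.sum_nonneg fun i _ => sv_nonneg X i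

lemma nuclearNorm_add_le (X Y : Matrix (Fin n) (Fin n) ℝ) :
    nuclearNorm (X + Y) ≤ nuclearNorm X + nuclearNorm Y := by
  obtain ⟨Z, hZ, h⟩ := exists_trace_transpose_mul_eq (X + Y)
  rw [← h, Matrix.mul_add, trace_add]
  have h1 := trace_transpose_mul_le Z X
  have h2 := trace_transpose_mul_le Z Y
  nlinarith [nuclearNorm_nonneg X, nuclearNorm_nonneg Y]

lemma nuclearNorm_neg (X : Matrix (Fin n) (Fin n) ℝ) : nuclearNorm (-X) = nuclearNorm X := by
  have key : ∀ Y : Matrix (Fin n) (Fin n) ℝ, nuclearNorm (-Y) ≤ nuclearNorm Y := by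
    intro Y
    obtain ⟨Z, hZ, h⟩ := exists_trace_transpose_mul_eq (-Y)
    have h1 := trace_transpose_mul_le (-Z) Y
    rw [opNorm_neg, transpose_neg, Matrix.neg_mul, ← Matrix.mul_neg, h] at h1
    nlinarith [nuclearNorm_nonneg Y]
  refine le_antisymm (key X) ?_
  simpa using key (-X)

lemma nuclearNorm_mul_mul_le (A X B : Matrix (Fin n) (Fin n) ℝ) :
    nuclearNorm (A * X * B) ≤ opNorm A * nuclearNorm X * opNorm B := by
  obtain ⟨Z, hZ, h⟩ := exists_trace_transpose_mul_eq (A * X * B)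
  have h1 := trace_transpose_mul_le (Aᵀ * Z * Bᵀ) X
  have h2 : trace ((Aᵀ * Z * Bᵀ)ᵀ * X) = nuclearNorm (A * X * B) := by
    rw [← h]
    simp only [transpose_mul, transpose_transpose, Matrix.mul_assoc]
    rw [trace_mul_comm]
    simp only [Matrix.mul_assoc]
  rw [h2] at h1
  have h3 : opNorm (Aᵀ * Z * Bᵀ) ≤ opNorm A * 1 * opNorm B := by
    refine (opNorm_mul_le _ _).trans ?_
    rw [opNorm_transpose B]
    refine mul_le_mul_of_nonneg_right ?_ (opNorm_nonneg _)
    refine (opNorm_mul_le _ _).trans ?_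
    rw [opNorm_transpose A]
    exact mul_le_mul_of_nonneg_left hZ (opNorm_nonneg _)
  calc _ ≤ _ := h1
    _ ≤ (opNorm A * 1 * opNorm B) * nuclearNorm X :=
        mul_le_mul_of_nonneg_right h3 (nuclearNorm_nonneg _)
    _ = _ := by ring

/-! ### Pinching -/

/-- Pinching: compressing to two complementary diagonal blocks does not increase the nuclear
norm. -/
lemma nuclearNorm_pinching {P P' : Matrix (Fin n) (Fin n) ℝ} (hP : Pᵀ = P) (hPP : P * P = P)
    (hP' : P'ᵀ = P') (hPP' : P' * P' = P') (X : Matrix (Fin n) (Fin n) ℝ) :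
    nuclearNorm (P * X * P') + nuclearNorm ((1 - P) * X * (1 - P')) ≤ nuclearNorm X := by
  obtain ⟨Y, hY, hYX⟩ := exists_trace_transpose_mul_eq (P * X * P')
  obtain ⟨Z, hZ, hZX⟩ := exists_trace_transpose_mul_eq ((1 - P) * X * (1 - P'))
  -- The block sum of the two dual certificates is again a contraction.
  set W := P * Y * P' + (1 - P) * Z * (1 - P') with hW
  have hWX : trace (Wᵀ * X) = nuclearNorm (P * X * P') + nuclearNorm ((1 - P) * X * (1 - P')) := by
    rw [← hYX, ← hZX, hW]
    have key : ∀ A B C : Matrix (Fin n) (Fin n) ℝ, trace ((A * B * C)ᵀ * X)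
        = trace (Bᵀ * (Aᵀ * X * Cᵀ)) := by
      intro A B C
      simp only [transpose_mul, Matrix.mul_assoc]
      rw [trace_mul_comm]
      simp only [Matrix.mul_assoc]
    rw [transpose_add, Matrix.add_mul, trace_add, key, key]
    simp only [transpose_sub, transpose_one, hP, hP']
  have hpyth : ∀ {S : Matrix (Fin n) (Fin n) ℝ}, Sᵀ = S → S * S = S →
      ∀ x y : EuclideanSpace ℝ (Fin n),
        ‖toEuclideanLin S x + toEuclideanLin (1 - S) y‖ ^ 2
          = ‖toEuclideanLin S x‖ ^ 2 + ‖toEuclideanLin (1 - S) y‖ ^ 2 := by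
    intro S hS hSS x y
    have : inner ℝ (toEuclideanLin S x) (toEuclideanLin (1 - S) y) = 0 := by
      rw [inner_toEuclideanLin_left, hS, ← toEuclideanLin_mul_apply, Matrix.mul_sub, hSS]
      simp
    rw [norm_add_sq_real, this]
    ring
  have hle : opNorm W ≤ 1 := by
    rw [opNorm_le_iff zero_le_one]
    intro x
    rw [one_mul]
    refine le_of_sq_le_sq ?_ (norm_nonneg _)
    have hsplit : ∀ {S : Matrix (Fin n) (Fin n) ℝ}, Sᵀ = S → S * S = S →
        ∀ y : EuclideanSpace ℝ (Fin n),
          ‖y‖ ^ 2 = ‖toEuclideanLin S y‖ ^ 2 + ‖toEuclideanLin (1 - S) y‖ ^ 2 := by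
      intro S hS hSS y
      rw [← hpyth hS hSS, ← LinearMap.add_apply, ← map_add, add_sub_cancel]
      simp [toEuclideanLin]
    have hcontr : ∀ {A : Matrix (Fin n) (Fin n) ℝ}, opNorm A ≤ 1 →
        ∀ y : EuclideanSpace ℝ (Fin n), ‖toEuclideanLin A y‖ ^ 2 ≤ ‖y‖ ^ 2 := by
      intro A hA y
      have := (opNorm_le_iff zero_le_one).1 hA y
      rw [one_mul] at this
      gcongr
    have hWx : toEuclideanLin W x
        = toEuclideanLin P (toEuclideanLin Y (toEuclideanLin P' x))
          + toEuclideanLin (1 - P) (toEuclideanLin Z (toEuclideanLin (1 - P') x)) := by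
      rw [hW, map_add, LinearMap.add_apply]
      simp only [toEuclideanLin_mul_apply]
    rw [hWx, hpyth hP hPP, hsplit hP' hPP' x]
    have h1 := hcontr hY (toEuclideanLin P' x)
    have h2 := hcontr hZ (toEuclideanLin (1 - P') x)
    have h3 := hsplit hP hPP (toEuclideanLin Y (toEuclideanLin P' x))
    have h4 := hsplit hP hPP (toEuclideanLin Z (toEuclideanLin (1 - P') x))
    have h5 := sq_nonneg ‖toEuclideanLin (1 - P) (toEuclideanLin Y (toEuclideanLin P' x))‖
    have h6 := sq_nonneg ‖toEuclideanLin P (toEuclideanLin Z (toEuclideanLin (1 - P') x))‖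
    linarith
  rw [← hWX]
  calc _ ≤ _ := trace_transpose_mul_le W X
    _ ≤ 1 * nuclearNorm X := mul_le_mul_of_nonneg_right hle (nuclearNorm_nonneg _)
    _ = _ := one_mul _

/-! ### Norm comparisons and the decomposition into blocks of singular values -/

lemma norm_sq_eq_sum_sv (X : Matrix (Fin n) (Fin n) ℝ) : ‖X‖ ^ 2 = ∑ i : Fin n, sv X i ^ 2 := by
  obtain ⟨V, hV, hV', hX⟩ := exists_orthogonal_diagonalizing X
  rw [norm_sq_eq_trace, ← trace_diagonal, ← hX, Matrix.mul_assoc, trace_mul_comm Vᵀ,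
    Matrix.mul_assoc, hV', Matrix.mul_one]

lemma sv_le_opNorm (X : Matrix (Fin n) (Fin n) ℝ) (i : ℕ) : sv X i ≤ opNorm X := by
  rcases le_or_gt n i with hi | hi
  · rw [sv_of_le X hi]
    exact opNorm_nonneg _
  obtain ⟨V, hV, hV', hX⟩ := exists_orthogonal_diagonalizing X
  have h1 : opNorm (X * V) ≤ opNorm X := by
    refine (opNorm_mul_le _ _).trans ?_
    exact mul_le_of_le_one_right (opNorm_nonneg _) (opNorm_le_one_of_transpose_mul_self hV)
  have h2 : (X * V)ᵀ * (X * V) = diagonal fun i : Fin n => sv X i ^ 2 := by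
    rw [← hX]
    simp only [transpose_mul, Matrix.mul_assoc]
  have h3 : opNorm (diagonal fun i : Fin n => sv X i ^ 2) = ‖fun i : Fin n => sv X i ^ 2‖ :=
    l2_opNorm_diagonal (𝕜 := ℝ) _
  have h4 := norm_le_pi_norm (fun i : Fin n => sv X i ^ 2) ⟨i, hi⟩
  rw [← h3, ← h2, opNorm_transpose_mul_self, Real.norm_of_nonneg (sq_nonneg _)] at h4
  exact (le_of_sq_le_sq h4 (opNorm_nonneg _)).trans h1

lemma nuclearNorm_eq_sum_rank (X : Matrix (Fin n) (Fin n) ℝ) {k : ℕ} (hk : X.rank ≤ k) :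
    nuclearNorm X = ∑ i ∈ Finset.range k, sv X i := by
  have h1 : nuclearNorm X = ∑ i ∈ Finset.range (n + k), sv X i := by
    refine Finset.sum_subset (fun i hi => ?_) fun i _ hi => ?_
    · simp only [Finset.mem_range] at hi ⊢
      omega
    · exact sv_of_le X (by simpa using hi)
  rw [h1]
  refine (Finset.sum_subset (fun i hi => ?_) fun i _ hi => ?_).symm
  · simp only [Finset.mem_range] at hi ⊢
    omega
  · exact sv_of_rank_le X (hk.trans (by simpa using hi))

lemma nuclearNorm_le_mul_opNorm (X : Matrix (Fin n) (Fin n) ℝ) {k : ℕ} (hk : X.rank ≤ k) :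
    nuclearNorm X ≤ k * opNorm X := by
  rw [nuclearNorm_eq_sum_rank X hk]
  refine (Finset.sum_le_card_nsmul _ _ (opNorm X) fun i _ => sv_le_opNorm X i).trans ?_
  simp

lemma norm_sq_eq_sum_rank (X : Matrix (Fin n) (Fin n) ℝ) {k : ℕ} (hk : X.rank ≤ k) :
    ‖X‖ ^ 2 = ∑ i ∈ Finset.range k, sv X i ^ 2 := by
  have h1 : ‖X‖ ^ 2 = ∑ i ∈ Finset.range (n + k), sv X i ^ 2 := by
    rw [norm_sq_eq_sum_sv, ← Finset.sum_range (fun i => sv X i ^ 2)]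
    refine Finset.sum_subset (fun i hi => ?_) fun i _ hi => ?_
    · simp only [Finset.mem_range] at hi ⊢
      omega
    · rw [sv_of_le X (by simpa using hi)]
      simp
  rw [h1]
  refine (Finset.sum_subset (fun i hi => ?_) fun i _ hi => ?_).symm
  · simp only [Finset.mem_range] at hi ⊢
    omega
  · rw [sv_of_rank_le X (hk.trans (by simpa using hi))]
    simp

lemma nuclearNorm_le_sqrt_mul_norm (X : Matrix (Fin n) (Fin n) ℝ) {k : ℕ} (hk : X.rank ≤ k) :
    nuclearNorm X ≤ √k * ‖X‖ := by
  rw [nuclearNorm_eq_sum_rank X hk]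
  refine le_of_sq_le_sq ?_ (by positivity)
  rw [mul_pow, Real.sq_sqrt (Nat.cast_nonneg k), norm_sq_eq_sum_rank X hk]
  refine (sq_sum_le_card_mul_sum_sq).trans ?_
  rw [Finset.card_range]

lemma norm_le_sqrt_mul_opNorm (X : Matrix (Fin n) (Fin n) ℝ) {k : ℕ} (hk : X.rank ≤ k) :
    ‖X‖ ≤ √k * opNorm X := by
  refine le_of_sq_le_sq ?_ (mul_nonneg (Real.sqrt_nonneg _) (opNorm_nonneg _))
  rw [mul_pow, Real.sq_sqrt (Nat.cast_nonneg k), norm_sq_eq_sum_rank X hk]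
  refine (Finset.sum_le_card_nsmul _ _ (opNorm X ^ 2) fun i _ =>
    pow_le_pow_left₀ (sv_nonneg X i) (sv_le_opNorm X i) 2).trans ?_
  simp

lemma sum_range_sv_le_nuclearNorm (X : Matrix (Fin n) (Fin n) ℝ) (m : ℕ) :
    ∑ i ∈ Finset.range m, sv X i ≤ nuclearNorm X := by
  have h := nuclearNorm_eq_sum_rank X (Nat.le_add_right X.rank m)
  rw [h]
  refine Finset.sum_le_sum_of_subset_of_nonneg (fun i hi => ?_) fun i _ _ => sv_nonneg X i
  simp only [Finset.mem_range] at hi ⊢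
  omega

/-- Splitting a matrix along its singular value decomposition into pieces of rank at most `k`, in
the order of decreasing singular values: every singular value in a later piece is at most the
average of those in the piece before, which bounds the later pieces by the nuclear norm. The pieces
inherit the left and right annihilators of `X`. -/
lemma exists_block_decomposition (X : Matrix (Fin n) (Fin n) ℝ) {k : ℕ} (hk : 0 < k) :
    ∃ (T : ℕ → Matrix (Fin n) (Fin n) ℝ) (N : ℕ),
      X = T 0 + ∑ j ∈ Finset.range N, T (j + 1) ∧ (∀ j, (T j).rank ≤ k) ∧
      ∑ j ∈ Finset.range N, ‖T (j + 1)‖ ≤ nuclearNorm X / √k ∧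
      opNorm (∑ j ∈ Finset.range N, T (j + 1)) ≤ nuclearNorm X / k ∧
      (∀ A j, A * X = 0 → A * T j = 0) ∧ (∀ B j, X * B = 0 → T j * B = 0) := by
  obtain ⟨V, hV, hV', hX⟩ := exists_orthogonal_diagonalizing X
  have hk' : (0 : ℝ) < k := by exact_mod_cast hk
  set d : ℕ → Fin n → ℝ := fun j i => if (i : ℕ) / k = j then 1 else 0 with hd
  have hgram : ∀ c : Fin n → ℝ, (X * V * diagonal c * Vᵀ)ᵀ * (X * V * diagonal c * Vᵀ)
      = V * diagonal (fun i : Fin n => c i * sv X i ^ 2 * c i) * Vᵀ := by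
    intro c
    calc _ = V * (diagonal c * (Vᵀ * (Xᵀ * X) * V) * diagonal c) * Vᵀ := by
          simp only [transpose_mul, transpose_transpose, diagonal_transpose, Matrix.mul_assoc]
      _ = _ := by rw [hX, diagonal_mul_diagonal, diagonal_mul_diagonal]
  have hop : ∀ (c : Fin n → ℝ) (m : ℕ), (∀ i, |c i| ≤ 1) → (∀ i : Fin n, (i : ℕ) < m → c i = 0) →
      opNorm (X * V * diagonal c * Vᵀ) ≤ sv X m := by
    intro c m hc hcm
    refine le_of_sq_le_sq ?_ (sv_nonneg X m)
    rw [← opNorm_transpose_mul_self, hgram]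
    refine opNorm_mul_diagonal_mul_transpose_le hV (sq_nonneg _) fun i => ?_
    rcases lt_or_ge (i : ℕ) m with hi | hi
    · simp [hcm i hi, sq_nonneg]
    · have h1 := pow_le_pow_left₀ (sv_nonneg _ _) (sv_antitone X hi) 2
      have h2 : |c i| * |c i| ≤ 1 := mul_le_one₀ (hc i) (abs_nonneg _) (hc i)
      rw [mul_right_comm, abs_mul, abs_mul, abs_of_nonneg (sq_nonneg (sv X i))]
      calc _ ≤ 1 * sv X i ^ 2 := mul_le_mul_of_nonneg_right h2 (sq_nonneg _)
        _ ≤ _ := by rwa [one_mul]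
  have hrank : ∀ j, (X * V * diagonal (d j) * Vᵀ).rank ≤ k := by
    intro j
    refine (rank_mul_le_left _ _).trans ((rank_mul_le_right _ _).trans ?_)
    rw [rank_diagonal, Fintype.card_subtype]
    have h1 : ((Finset.univ.filter fun i : Fin n => d j i ≠ 0).map Fin.valEmbedding)
        ⊆ Finset.Ico (j * k) ((j + 1) * k) := by
      intro i hi
      simp only [hd, Finset.mem_map, Finset.mem_filter, Fin.valEmbedding_apply] at hi
      obtain ⟨a, ⟨-, ha⟩, rfl⟩ := hi
      have ha' : (a : ℕ) / k = j := by
        by_contra h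
        simp [h] at ha
      rw [Nat.div_eq_iff hk] at ha'
      rw [Finset.mem_Ico, add_mul, one_mul]
      omega
    have h2 := Finset.card_le_card h1
    rw [Finset.card_map, Nat.card_Ico, add_mul, one_mul, Nat.add_sub_cancel_left] at h2
    exact h2
  have htail : ∑ j ∈ Finset.range n, X * V * diagonal (d (j + 1)) * Vᵀ
      = X * V * diagonal (fun i : Fin n => if (i : ℕ) < k then 0 else 1) * Vᵀ := by
    rw [← Finset.sum_mul, ← Finset.mul_sum]
    congr 2
    have : ∑ j ∈ Finset.range n, diagonal (d (j + 1))
        = diagonal (∑ j ∈ Finset.range n, d (j + 1)) :=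
      (map_sum (diagonalAddMonoidHom (Fin n) ℝ) _ _).symm
    rw [this]
    congr 1
    ext i
    rw [Finset.sum_apply]
    simp only [hd]
    split_ifs with hi
    · refine Finset.sum_eq_zero fun j _ => ?_
      simp [Nat.div_eq_of_lt hi]
    · have h1 : 1 ≤ (i : ℕ) / k := (Nat.one_le_div_iff hk).2 (not_lt.1 hi)
      have h2 : (i : ℕ) / k ≤ i := Nat.div_le_self _ _
      rw [Finset.sum_eq_single ((i : ℕ) / k - 1)]
      · simp [Nat.sub_add_cancel h1]
      · intro j _ hj
        rw [if_neg]
        omega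
      · intro h
        simp only [Finset.mem_range] at h
        omega
  refine ⟨fun j => X * V * diagonal (d j) * Vᵀ, n, ?_, ?_, ?_, ?_, ?_, ?_⟩
  · rw [htail, ← Matrix.add_mul, ← Matrix.mul_add, diagonal_add]
    have : (fun i : Fin n => d 0 i + if (i : ℕ) < k then 0 else 1) = fun _ => 1 := by
      ext i
      simp only [hd, Nat.div_eq_zero_iff, hk.ne', false_or]
      split_ifs <;> simp
    rw [this, diagonal_one, Matrix.mul_one, Matrix.mul_assoc, hV', Matrix.mul_one]
  · exact hrank
  · have hblocks : ∀ m, ∑ i ∈ Finset.range (m * k), sv X i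
        = ∑ j ∈ Finset.range m, ∑ l ∈ Finset.range k, sv X (j * k + l) := by
      intro m
      induction m with
      | zero => simp
      | succ m ih => rw [Finset.sum_range_succ, ← ih, add_mul, one_mul, Finset.sum_range_add]
    have hblock : ∀ j, ‖X * V * diagonal (d (j + 1)) * Vᵀ‖
        ≤ (∑ l ∈ Finset.range k, sv X (j * k + l)) / √k := by
      intro j
      have h1 : opNorm (X * V * diagonal (d (j + 1)) * Vᵀ) ≤ sv X ((j + 1) * k) := by
        refine hop _ _ (fun i => ?_) fun i hi => ?_
        · simp only [hd]
          split_ifs <;> simp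
        · simp only [hd, ite_eq_right_iff]
          intro h
          have := Nat.div_lt_of_lt_mul (mul_comm (j + 1) k ▸ hi)
          omega
      have h2 : (k : ℝ) * sv X ((j + 1) * k) ≤ ∑ l ∈ Finset.range k, sv X (j * k + l) := by
        have h3 := Finset.card_nsmul_le_sum (Finset.range k) (fun l => sv X (j * k + l))
          (sv X ((j + 1) * k)) fun l hl => sv_antitone X <| by
            rw [add_mul, one_mul]
            exact Nat.add_le_add_left (Finset.mem_range.1 hl).le _
        rwa [Finset.card_range, nsmul_eq_mul] at h3
      rw [le_div_iff₀ (Real.sqrt_pos.2 hk')]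
      calc _ ≤ √k * sv X ((j + 1) * k) * √k := by
            refine mul_le_mul_of_nonneg_right ?_ (Real.sqrt_nonneg _)
            exact (norm_le_sqrt_mul_opNorm _ (hrank _)).trans
              (mul_le_mul_of_nonneg_left h1 (Real.sqrt_nonneg _))
        _ = k * sv X ((j + 1) * k) := by
            rw [mul_right_comm, Real.mul_self_sqrt hk'.le]
        _ ≤ _ := h2
    calc _ ≤ ∑ j ∈ Finset.range n, (∑ l ∈ Finset.range k, sv X (j * k + l)) / √k :=
          Finset.sum_le_sum fun j _ => hblock j
      _ = (∑ i ∈ Finset.range (n * k), sv X i) / √k := by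
          rw [← Finset.sum_div]
          congr 1
          exact (hblocks n).symm
      _ ≤ _ := by
          gcongr
          exact sum_range_sv_le_nuclearNorm X _
  · rw [htail]
    have h1 : opNorm (X * V * diagonal (fun i : Fin n => if (i : ℕ) < k then 0 else 1) * Vᵀ)
        ≤ sv X k :=
      hop _ _ (fun i => by split_ifs <;> simp) fun i hi => if_pos hi
    refine h1.trans ?_
    rw [le_div_iff₀ hk']
    refine le_trans ?_ (sum_range_sv_le_nuclearNorm X k)
    have h2 := Finset.card_nsmul_le_sum (Finset.range k) (sv X) (sv X k) fun i hi =>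
      sv_antitone X (Finset.mem_range.1 hi).le
    rw [Finset.card_range, nsmul_eq_mul] at h2
    linarith
  · intro A j hA
    simp only [← Matrix.mul_assoc, hA, Matrix.zero_mul]
  · intro B j hB
    -- The singular vectors with nonzero singular value are orthogonal to the columns of `B`.
    have h1 : diagonal (fun i : Fin n => sv X i ^ 2) * (Vᵀ * B) = 0 := by
      rw [← hX]
      calc _ = Vᵀ * Xᵀ * (X * ((V * Vᵀ) * B)) := by simp only [Matrix.mul_assoc]
        _ = 0 := by rw [hV', Matrix.one_mul, hB, Matrix.mul_zero]
    have h2 : (X * V * diagonal (d j) * Vᵀ * B)ᵀ * (X * V * diagonal (d j) * Vᵀ * B) = 0 := by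
      rw [transpose_mul]
      calc _ = Bᵀ * ((X * V * diagonal (d j) * Vᵀ)ᵀ * (X * V * diagonal (d j) * Vᵀ)) * B := by
            simp only [Matrix.mul_assoc]
        _ = Bᵀ * V * (diagonal (fun i => d j i * d j i)
              * (diagonal (fun i : Fin n => sv X i ^ 2) * (Vᵀ * B))) := by
            rw [hgram, ← Matrix.mul_assoc (diagonal _) (diagonal _), diagonal_mul_diagonal]
            simp only [Matrix.mul_assoc, mul_right_comm (d j _)]
        _ = 0 := by rw [h1, Matrix.mul_zero, Matrix.mul_zero]
    rw [← conjTranspose_eq_transpose_of_trivial] at h2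
    exact conjTranspose_mul_self_eq_zero.1 h2

/-! ### Subspaces at a given largest principal angle -/

/-- A vector of `U` makes at most the largest principal angle with `W`. -/
lemma norm_starProjection_orthogonal_sq_le {U W : Submodule ℝ (EuclideanSpace ℝ (Fin n))}
    (hW : W ≠ ⊥) {x : EuclideanSpace ℝ (Fin n)} (hx : x ∈ U) :
    ‖Wᗮ.starProjection x‖ ^ 2 ≤ Real.sin (largestPrincipalAngle U W) ^ 2 * ‖x‖ ^ 2 := by
  have hpyth : ∀ x, ‖x‖ ^ 2 = ‖W.starProjection x‖ ^ 2 + ‖Wᗮ.starProjection x‖ ^ 2 :=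
    fun x => Submodule.norm_sq_eq_add_norm_sq_starProjection x W
  have key : ∀ x ∈ U, ‖x‖ = 1 →
      ‖Wᗮ.starProjection x‖ ^ 2 ≤ Real.sin (largestPrincipalAngle U W) ^ 2 := by
    intro x hx hx1
    set S := {y : EuclideanSpace ℝ (Fin n) // y ∈ W ∧ ‖y‖ = 1} with hS
    obtain ⟨z, hzW, hz0⟩ := W.ne_bot_iff.1 hW
    have hz1 : ‖(‖z‖⁻¹ • z : EuclideanSpace ℝ (Fin n))‖ = 1 := by
      rw [norm_smul, norm_inv, norm_norm, inv_mul_cancel₀ (norm_ne_zero_iff.2 hz0)]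
    let y₀ : S := ⟨‖z‖⁻¹ • z, W.smul_mem _ hzW, hz1⟩
    let y₁ : S := ⟨-(‖z‖⁻¹ • z), W.neg_mem (W.smul_mem _ hzW), by rw [norm_neg, hz1]⟩
    have : Nonempty S := ⟨y₀⟩
    have hbdd : ∀ x : EuclideanSpace ℝ (Fin n),
        BddBelow (Set.range fun y : S => InnerProductGeometry.angle x y.1) :=
      fun x => ⟨0, by rintro _ ⟨y, rfl⟩; exact InnerProductGeometry.angle_nonneg _ _⟩
    have hinf : ∀ x : EuclideanSpace ℝ (Fin n),
        (⨅ y : S, InnerProductGeometry.angle x y.1) ≤ Real.pi / 2 := by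
      intro x
      rcases le_total (InnerProductGeometry.angle x y₀.1) (Real.pi / 2) with h | h
      · exact (ciInf_le (hbdd x) y₀).trans h
      · refine (ciInf_le (hbdd x) y₁).trans ?_
        change InnerProductGeometry.angle x (-y₀.1) ≤ _
        rw [InnerProductGeometry.angle_neg_right]
        linarith
    have : Nonempty {x : EuclideanSpace ℝ (Fin n) // x ∈ U ∧ ‖x‖ = 1} := ⟨⟨x, hx, hx1⟩⟩
    have hle : largestPrincipalAngle U W ≤ Real.pi / 2 := ciSup_le fun x => hinf x.1
    have hge : (⨅ y : S, InnerProductGeometry.angle x y.1) ≤ largestPrincipalAngle U W :=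
      le_ciSup (f := fun x : {x : EuclideanSpace ℝ (Fin n) // x ∈ U ∧ ‖x‖ = 1} =>
        ⨅ y : S, InnerProductGeometry.angle x.1 y.1)
        ⟨Real.pi / 2, by rintro _ ⟨x, rfl⟩; exact hinf x.1⟩ ⟨x, hx, hx1⟩
    have harccos :
        Real.arccos ‖W.starProjection x‖ ≤ ⨅ y : S, InnerProductGeometry.angle x y.1 := by
      refine le_ciInf fun y => ?_
      unfold InnerProductGeometry.angle
      refine Real.arccos_le_arccos ?_
      rw [hx1, y.2.2, one_mul, div_one, ← (Submodule.starProjection_eq_self_iff).2 y.2.1,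
        ← Submodule.inner_starProjection_left_eq_right]
      refine (real_inner_le_norm _ _).trans ?_
      rw [y.2.2, mul_one]
    have hnorm : ‖W.starProjection x‖ ≤ 1 := by
      have := W.norm_starProjection_apply_le x
      rwa [hx1] at this
    have hcos : Real.cos (largestPrincipalAngle U W) ≤ ‖W.starProjection x‖ := by
      rw [← Real.cos_arccos (by linarith [norm_nonneg (W.starProjection x)]) hnorm]
      exact Real.cos_le_cos_of_nonneg_of_le_pi (Real.arccos_nonneg _) (by linarith [Real.pi_pos])
        (harccos.trans hge)
    have hcos0 : 0 ≤ Real.cos (largestPrincipalAngle U W) := by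
      refine Real.cos_nonneg_of_neg_pi_div_two_le_of_le ?_ hle
      linarith [Real.arccos_nonneg ‖W.starProjection x‖, Real.pi_pos]
    have h1 := hpyth x
    rw [hx1] at h1
    have h2 := Real.sin_sq_add_cos_sq (largestPrincipalAngle U W)
    nlinarith
  rcases eq_or_ne x 0 with rfl | hx0
  · simp
  have hn : ‖x‖ ≠ 0 := norm_ne_zero_iff.2 hx0
  have h := key (‖x‖⁻¹ • x) (U.smul_mem _ hx) (by
    rw [norm_smul, norm_inv, norm_norm, inv_mul_cancel₀ hn])
  rw [map_smul, norm_smul, norm_inv, norm_norm, mul_pow] at h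
  have h3 : ‖Wᗮ.starProjection x‖ ^ 2 = (‖x‖⁻¹ ^ 2 * ‖Wᗮ.starProjection x‖ ^ 2) * ‖x‖ ^ 2 := by
    field_simp
  rw [h3]
  gcongr

lemma exists_le_finrank_eq {V : Submodule ℝ (EuclideanSpace ℝ (Fin n))} {k : ℕ}
    (hk : k ≤ Module.finrank ℝ V) : ∃ N ≤ V, Module.finrank ℝ N = k := by
  let b := Module.finBasis ℝ V
  have hli : LinearIndependent ℝ
      fun i : Fin k => (b (Fin.castLE hk i) : EuclideanSpace ℝ (Fin n)) :=
    (b.linearIndependent.comp _ (Fin.castLE_injective hk)).map' V.subtype V.ker_subtype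
  refine ⟨Submodule.span ℝ (Set.range fun i : Fin k =>
    (b (Fin.castLE hk i) : EuclideanSpace ℝ (Fin n))), ?_, ?_⟩
  · rw [Submodule.span_le]
    rintro _ ⟨i, rfl⟩
    exact (b (Fin.castLE hk i)).2
  · rw [finrank_span_eq_card hli, Fintype.card_fin]

/-- A subspace `U` of dimension at most `dim W` can be enlarged inside `U ⊔ W` to one of the same
dimension as `W` that stays as close to `W`. -/
lemma exists_le_finrank_eq_norm_starProjection_le {U W : Submodule ℝ (EuclideanSpace ℝ (Fin n))}
    (hUW : Module.finrank ℝ U ≤ Module.finrank ℝ W) {t : ℝ} (ht : 0 ≤ t)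
    (h : ∀ x ∈ U, ‖Wᗮ.starProjection x‖ ^ 2 ≤ t * ‖x‖ ^ 2) :
    ∃ U' : Submodule ℝ (EuclideanSpace ℝ (Fin n)), U ≤ U' ∧
      Module.finrank ℝ U' = Module.finrank ℝ W ∧
      ∀ x ∈ U', ‖Wᗮ.starProjection x‖ ^ 2 ≤ t * ‖x‖ ^ 2 := by
  have h1 : Module.finrank ℝ W - Module.finrank ℝ U
      ≤ Module.finrank ℝ (W ⊓ Uᗮ : Submodule ℝ (EuclideanSpace ℝ (Fin n))) := by
    have h2 := Submodule.finrank_sup_add_finrank_inf_eq W Uᗮ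
    have h3 := U.finrank_add_finrank_orthogonal
    have h4 := (W ⊔ Uᗮ).finrank_le
    omega
  obtain ⟨N, hN, hNr⟩ := exists_le_finrank_eq h1
  have hNW : N ≤ W := hN.trans inf_le_left
  have hNU : N ≤ Uᗮ := hN.trans inf_le_right
  refine ⟨U ⊔ N, le_sup_left, ?_, ?_⟩
  · have h2 := Submodule.finrank_sup_add_finrank_inf_eq U N
    have h3 : U ⊓ N = ⊥ := eq_bot_iff.2 ((inf_le_inf_left U hNU).trans U.inf_orthogonal_eq_bot.le)
    rw [h3, finrank_bot] at h2
    omega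
  · intro x hx
    obtain ⟨u, hu, z, hz, rfl⟩ := Submodule.mem_sup.1 hx
    have h2 : Wᗮ.starProjection z = 0 := by
      rw [Submodule.starProjection_apply_eq_zero_iff, Submodule.orthogonal_orthogonal]
      exact hNW hz
    rw [map_add, h2, add_zero]
    refine (h u hu).trans (mul_le_mul_of_nonneg_left ?_ ht)
    have h3 : inner ℝ u z = 0 := hNU hz u hu
    rw [norm_add_sq_real, h3]
    nlinarith [sq_nonneg ‖z‖]

/-- For subspaces of equal dimension closeness is symmetric, so it passes to the complements. -/
lemma norm_starProjection_sq_le_of_mem_orthogonal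
    {U W : Submodule ℝ (EuclideanSpace ℝ (Fin n))}
    (hUW : Module.finrank ℝ U = Module.finrank ℝ W) {t : ℝ} (ht0 : 0 ≤ t)
    (h : ∀ x ∈ U, ‖Wᗮ.starProjection x‖ ^ 2 ≤ t * ‖x‖ ^ 2)
    {w : EuclideanSpace ℝ (Fin n)} (hw : w ∈ Uᗮ) :
    ‖W.starProjection w‖ ^ 2 ≤ t * ‖w‖ ^ 2 := by
  have hpyth : ∀ x, ‖x‖ ^ 2 = ‖W.starProjection x‖ ^ 2 + ‖Wᗮ.starProjection x‖ ^ 2 :=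
    fun x => Submodule.norm_sq_eq_add_norm_sq_starProjection x W
  rcases le_or_gt 1 t with ht | ht
  · have h1 := hpyth w
    nlinarith [sq_nonneg ‖Wᗮ.starProjection w‖, sq_nonneg ‖w‖]
  -- The projection onto `W` is a bijection from `U` onto `W`.
  let f : U →ₗ[ℝ] W :=
    ((W.starProjection : EuclideanSpace ℝ (Fin n) →ₗ[ℝ] _).comp U.subtype).codRestrict W
      fun x => Submodule.starProjection_apply_mem W x
  have hf : Function.Injective f := by
    rw [← LinearMap.ker_eq_bot, LinearMap.ker_eq_bot']
    intro x hx
    have h1 : W.starProjection (x : EuclideanSpace ℝ (Fin n)) = 0 := congrArg Subtype.val hx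
    have h2 := hpyth (x : EuclideanSpace ℝ (Fin n))
    have h3 := h x x.2
    rw [h1, norm_zero] at h2
    have h4 : ‖(x : EuclideanSpace ℝ (Fin n))‖ ^ 2 = 0 := by
      nlinarith [sq_nonneg ‖(x : EuclideanSpace ℝ (Fin n))‖]
    simpa using h4
  obtain ⟨x, hx⟩ := (LinearMap.injective_iff_surjective_of_finrank_eq_finrank hUW).1 hf
    ⟨W.starProjection w, Submodule.starProjection_apply_mem W w⟩
  replace hx : W.starProjection (x : EuclideanSpace ℝ (Fin n)) = W.starProjection w :=
    congrArg Subtype.val hx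
  have hwx : inner ℝ w (x : EuclideanSpace ℝ (Fin n)) = 0 := by
    rw [real_inner_comm]
    exact hw x x.2
  have hself : ∀ v, inner ℝ v (W.starProjection v) = ‖W.starProjection v‖ ^ 2 := by
    intro v
    rw [← (Submodule.starProjection_eq_self_iff).2 (Submodule.starProjection_apply_mem W v),
      ← Submodule.inner_starProjection_left_eq_right,
      (Submodule.starProjection_eq_self_iff).2 (Submodule.starProjection_apply_mem W v),
      real_inner_self_eq_norm_sq]
  have h1 := hself w
  have h2 := hself x
  rw [hx] at h2
  have h3 := hpyth x
  have h4 := h x x.2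
  rw [hx] at h3
  set z := W.starProjection w with hz
  rcases eq_or_ne z 0 with hz0 | hz0
  · rw [hz0, norm_zero, zero_pow two_ne_zero]
    positivity
  -- Cauchy–Schwarz for `w` and the part of `z` orthogonal to `x`, scaled by `‖x‖ ^ 2`.
  have h5 : inner ℝ w (‖(x : EuclideanSpace ℝ (Fin n))‖ ^ 2 • z
      - ‖z‖ ^ 2 • (x : EuclideanSpace ℝ (Fin n)))
      = ‖(x : EuclideanSpace ℝ (Fin n))‖ ^ 2 * ‖z‖ ^ 2 := by
    rw [inner_sub_right, inner_smul_right, inner_smul_right, h1, hwx]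
    ring
  have h6 : ‖‖(x : EuclideanSpace ℝ (Fin n))‖ ^ 2 • z
      - ‖z‖ ^ 2 • (x : EuclideanSpace ℝ (Fin n))‖ ^ 2
      = ‖(x : EuclideanSpace ℝ (Fin n))‖ ^ 2 * ‖z‖ ^ 2 * ‖Wᗮ.starProjection x‖ ^ 2 := by
    rw [norm_sub_sq_real, inner_smul_left, inner_smul_right, real_inner_comm, h2, norm_smul,
      norm_smul]
    simp only [norm_pow, norm_norm, conj_trivial]
    have : ‖Wᗮ.starProjection x‖ ^ 2 = ‖(x : EuclideanSpace ℝ (Fin n))‖ ^ 2 - ‖z‖ ^ 2 := by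
      linarith
    rw [this]
    ring
  have h7 := abs_real_inner_le_norm w (‖(x : EuclideanSpace ℝ (Fin n))‖ ^ 2 • z
      - ‖z‖ ^ 2 • (x : EuclideanSpace ℝ (Fin n)))
  rw [h5] at h7
  have h8 := pow_le_pow_left₀ (abs_nonneg _) h7 2
  rw [sq_abs, mul_pow ‖w‖, h6] at h8
  have hZ : 0 < ‖z‖ ^ 2 := by positivity
  have hX : 0 < ‖(x : EuclideanSpace ℝ (Fin n))‖ ^ 2 := by
    linarith [sq_nonneg ‖Wᗮ.starProjection (x : EuclideanSpace ℝ (Fin n))‖]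
  generalize ‖(x : EuclideanSpace ℝ (Fin n))‖ ^ 2 = X at *
  generalize ‖z‖ ^ 2 = Z at *
  refine le_of_mul_le_mul_left ?_ (mul_pos (mul_pos hX hX) hZ)
  calc X * X * Z * Z = (X * Z) ^ 2 := by ring
    _ ≤ ‖w‖ ^ 2 * (X * Z * ‖Wᗮ.starProjection x‖ ^ 2) := h8
    _ ≤ ‖w‖ ^ 2 * (X * Z * (t * X)) := by gcongr
    _ = X * X * Z * (t * ‖w‖ ^ 2) := by ring

/-! ### Projection and weight matrices -/

lemma transpose_eq_self_of_inner {A : Matrix (Fin n) (Fin n) ℝ}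
    (h : ∀ x y, inner ℝ (toEuclideanLin A x) y = inner ℝ x (toEuclideanLin A y)) : Aᵀ = A := by
  apply toEuclideanLin.injective
  ext1 y
  refine ext_inner_left ℝ fun x => ?_
  rw [← inner_toEuclideanLin_left, h]

lemma ext_toEuclideanLin {A B : Matrix (Fin n) (Fin n) ℝ}
    (h : ∀ x, toEuclideanLin A x = toEuclideanLin B x) : A = B :=
  toEuclideanLin.injective (LinearMap.ext h)

lemma rank_eq_finrank_range_toEuclideanLin (A : Matrix (Fin n) (Fin n) ℝ) :
    A.rank = Module.finrank ℝ (LinearMap.range (toEuclideanLin A)) := by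
  rw [rank_eq_finrank_range_toLin A (EuclideanSpace.basisFun (Fin n) ℝ).toBasis
    (EuclideanSpace.basisFun (Fin n) ℝ).toBasis, ← toEuclideanLin_eq_toLin_orthonormal]

@[simp]
lemma toEuclideanLin_one_apply (x : EuclideanSpace ℝ (Fin n)) :
    toEuclideanLin (1 : Matrix (Fin n) (Fin n) ℝ) x = x := by
  simp [toEuclideanLin]

section projMatrix

variable (W : Submodule ℝ (EuclideanSpace ℝ (Fin n)))

@[simp]
lemma toEuclideanLin_projMatrix (x : EuclideanSpace ℝ (Fin n)) :
    toEuclideanLin (projMatrix W) x = W.starProjection x := by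
  simp [projMatrix]

lemma projMatrix_transpose : (projMatrix W)ᵀ = projMatrix W :=
  transpose_eq_self_of_inner fun x y => by
    simp only [toEuclideanLin_projMatrix, Submodule.inner_starProjection_left_eq_right]

lemma projMatrix_mul_self : projMatrix W * projMatrix W = projMatrix W :=
  ext_toEuclideanLin fun x => by
    rw [toEuclideanLin_mul_apply]
    simp only [toEuclideanLin_projMatrix]
    exact Submodule.starProjection_eq_self_iff.2 (Submodule.starProjection_apply_mem W x)

lemma rank_projMatrix : (projMatrix W).rank = Module.finrank ℝ W := by
  rw [rank_eq_finrank_range_toEuclideanLin]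
  have : LinearMap.range (toEuclideanLin (projMatrix W)) = W := by
    ext x
    constructor
    · rintro ⟨y, rfl⟩
      rw [toEuclideanLin_projMatrix]
      exact Submodule.starProjection_apply_mem W y
    · intro hx
      exact ⟨x, by rw [toEuclideanLin_projMatrix, Submodule.starProjection_eq_self_iff.2 hx]⟩
  rw [this]

lemma toEuclideanLin_weightMatrix (w : ℝ) (x : EuclideanSpace ℝ (Fin n)) :
    toEuclideanLin (weightMatrix W w) x = w • W.starProjection x + Wᗮ.starProjection x := by
  simp [weightMatrix]

lemma weightMatrix_transpose (w : ℝ) : (weightMatrix W w)ᵀ = weightMatrix W w := by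
  rw [weightMatrix, transpose_add, transpose_smul, projMatrix_transpose, projMatrix_transpose]

end projMatrix

lemma norm_toEuclideanLin_weightMatrix_sq (W : Submodule ℝ (EuclideanSpace ℝ (Fin n))) (w : ℝ)
    (x : EuclideanSpace ℝ (Fin n)) : ‖toEuclideanLin (weightMatrix W w) x‖ ^ 2
      = w ^ 2 * ‖W.starProjection x‖ ^ 2 + ‖Wᗮ.starProjection x‖ ^ 2 := by
  have h : inner ℝ (W.starProjection x) (Wᗮ.starProjection x) = 0 :=
    (Submodule.starProjection_apply_mem Wᗮ x) _ (Submodule.starProjection_apply_mem W x)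
  rw [toEuclideanLin_weightMatrix, norm_add_sq_real, inner_smul_left, h, norm_smul, mul_pow,
    Real.norm_eq_abs, sq_abs]
  simp

lemma starProjection_toEuclideanLin_weightMatrix (W : Submodule ℝ (EuclideanSpace ℝ (Fin n)))
    (w : ℝ) (x : EuclideanSpace ℝ (Fin n)) :
    W.starProjection (toEuclideanLin (weightMatrix W w) x) = w • W.starProjection x := by
  have h1 : W.starProjection (W.starProjection x) = W.starProjection x :=
    Submodule.starProjection_eq_self_iff.2 (Submodule.starProjection_apply_mem W x)
  have h2 : W.starProjection (Wᗮ.starProjection x) = 0 :=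
    (Submodule.starProjection_apply_eq_zero_iff W).2 (Submodule.starProjection_apply_mem Wᗮ x)
  rw [toEuclideanLin_weightMatrix, map_add, map_smul, h1, h2, add_zero]

lemma starProjection_orthogonal_toEuclideanLin_weightMatrix
    (W : Submodule ℝ (EuclideanSpace ℝ (Fin n))) (w : ℝ) (x : EuclideanSpace ℝ (Fin n)) :
    Wᗮ.starProjection (toEuclideanLin (weightMatrix W w) x) = Wᗮ.starProjection x := by
  have h1 : Wᗮ.starProjection (Wᗮ.starProjection x) = Wᗮ.starProjection x :=
    Submodule.starProjection_eq_self_iff.2 (Submodule.starProjection_apply_mem Wᗮ x)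
  have h2 : Wᗮ.starProjection (W.starProjection x) = 0 := by
    rw [Submodule.starProjection_apply_eq_zero_iff, Submodule.orthogonal_orthogonal]
    exact Submodule.starProjection_apply_mem W x
  rw [toEuclideanLin_weightMatrix, map_add, map_smul, h1, h2, smul_zero, zero_add]

lemma weight_denominator_pos {w t : ℝ} (hw : 0 < w) (hw1 : w ≤ 1) (ht0 : 0 ≤ t) :
    0 < w ^ 2 * (1 - t) + t := by
  have h1 : w ^ 2 ≤ 1 := pow_le_one₀ hw.le hw1
  nlinarith [mul_pos hw hw, mul_nonneg ht0 (sub_nonneg.2 h1)]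

/-! ### Block structure of a weight matrix -/

/-- What the analysis uses about a weight matrix `Q` and a subspace `U` with projection `P`. The
subspace `Q U` has projection `S`, and with respect to the decompositions `U ⊕ Uᗮ` and
`Q U ⊕ (Q U)ᗮ` the matrix `Q` is block upper triangular. Its first block row `S Q` has norm at most
`a`, its off-diagonal block norm at most `x`, and the Gram matrix `Q (1 - S) Q` of its last diagonal
block differs from the identity of `Uᗮ` by a matrix `G` of rank at most `r` with `0 ≤ G ≤ x²`, the
bound being encoded as `G² ≤ x² G`. -/
structure IsWeightBlock (r : ℕ) (Q P S G : Matrix (Fin n) (Fin n) ℝ) (a x : ℝ) : Prop where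
  transpose_weight : Qᵀ = Q
  opNorm_weight_le : opNorm Q ≤ 1
  transpose_proj : Pᵀ = P
  proj_mul_self : P * P = P
  rank_proj_le : P.rank ≤ r
  transpose_image : Sᵀ = S
  image_mul_self : S * S = S
  rank_image_le : S.rank ≤ r
  image_mul_weight_mul : S * Q * P = Q * P
  opNorm_image_mul_weight_le : opNorm (S * Q) ≤ a
  opNorm_offDiag_le : opNorm (S * Q * (1 - P)) ≤ x
  transpose_gap : Gᵀ = G
  weight_mul_weight : Q * (1 - S) * Q = 1 - P - G
  gap_mul_proj : G * P = 0
  rank_gap_le : G.rank ≤ r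
  norm_gap_sq_le : ∀ v, ‖toEuclideanLin G v‖ ^ 2 ≤ x ^ 2 * inner ℝ v (toEuclideanLin G v)

/-- On the orthogonal complement of `U`, the last diagonal block of the weight matrix is bounded
below. The vector `y = Q⁻¹ w` lies in `(Q U)ᗮ` and tests this block: `‖w‖² = ⟪Q w, y⟫`. -/
lemma le_norm_orthogonal_image_sq {U W : Submodule ℝ (EuclideanSpace ℝ (Fin n))}
    {w t : ℝ} (hw : 0 < w) (hw1 : w ≤ 1) (ht0 : 0 ≤ t)
    {z : EuclideanSpace ℝ (Fin n)} (hz : z ∈ Uᗮ) (hzt : ‖W.starProjection z‖ ^ 2 ≤ t * ‖z‖ ^ 2) :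
    w ^ 2 / (w ^ 2 * (1 - t) + t) * ‖z‖ ^ 2
      ≤ ‖(U.map (toEuclideanLin (weightMatrix W w)))ᗮ.starProjection
          (toEuclideanLin (weightMatrix W w) z)‖ ^ 2 := by
  set Q := weightMatrix W w with hQ
  set S := U.map (toEuclideanLin Q) with hS
  set y := w⁻¹ • W.starProjection z + Wᗮ.starProjection z with hy
  have hD : 0 < w ^ 2 * (1 - t) + t := weight_denominator_pos hw hw1 ht0
  have hWW : W.starProjection (W.starProjection z) = W.starProjection z :=
    Submodule.starProjection_eq_self_iff.2 (Submodule.starProjection_apply_mem W z)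
  have hWW' : Wᗮ.starProjection (Wᗮ.starProjection z) = Wᗮ.starProjection z :=
    Submodule.starProjection_eq_self_iff.2 (Submodule.starProjection_apply_mem Wᗮ z)
  have hW0 : Wᗮ.starProjection (W.starProjection z) = 0 := by
    rw [Submodule.starProjection_apply_eq_zero_iff, Submodule.orthogonal_orthogonal]
    exact Submodule.starProjection_apply_mem W z
  have hW0' : W.starProjection (Wᗮ.starProjection z) = 0 := by
    rw [Submodule.starProjection_apply_eq_zero_iff]
    exact Submodule.starProjection_apply_mem Wᗮ z
  have hQy : toEuclideanLin Q y = z := by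
    rw [hQ, toEuclideanLin_weightMatrix, hy, map_add, map_add, map_smul, map_smul, hWW, hWW', hW0,
      hW0', smul_add, smul_smul, mul_inv_cancel₀ hw.ne']
    simp
  have hQs : ∀ a b, inner ℝ (toEuclideanLin Q a) b = inner ℝ a (toEuclideanLin Q b) := by
    intro a b
    rw [inner_toEuclideanLin_left, hQ, weightMatrix_transpose]
  have hyS : y ∈ Sᗮ := by
    rintro _ ⟨u, hu, rfl⟩
    rw [hQs, hQy]
    exact hz u hu
  have hnormy : ‖y‖ ^ 2 ≤ (w ^ 2 * (1 - t) + t) / w ^ 2 * ‖z‖ ^ 2 := by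
    have h1 : inner ℝ (W.starProjection z) (Wᗮ.starProjection z) = 0 :=
      (Submodule.starProjection_apply_mem Wᗮ z) _ (Submodule.starProjection_apply_mem W z)
    have h2 := Submodule.norm_sq_eq_add_norm_sq_starProjection z W
    have h3 : ‖y‖ ^ 2 = (w⁻¹ ^ 2 - 1) * ‖W.starProjection z‖ ^ 2 + ‖z‖ ^ 2 := by
      rw [hy, norm_add_sq_real, inner_smul_left, h1, norm_smul, mul_pow, Real.norm_eq_abs, sq_abs,
        h2]
      ring
    have h4 : 0 ≤ w⁻¹ ^ 2 - 1 := by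
      have : 1 ≤ w⁻¹ := (one_le_inv₀ hw).2 hw1
      nlinarith
    rw [h3]
    have h5 : (w ^ 2 * (1 - t) + t) / w ^ 2 = (w⁻¹ ^ 2 - 1) * t + 1 := by
      field_simp
      ring
    rw [h5]
    nlinarith [mul_le_mul_of_nonneg_left hzt h4]
  have h6 : ‖z‖ ^ 2 = inner ℝ (Sᗮ.starProjection (toEuclideanLin Q z)) y := by
    rw [Submodule.inner_starProjection_left_eq_right, Submodule.starProjection_eq_self_iff.2 hyS,
      hQs, hQy, real_inner_self_eq_norm_sq]
  have h7 : (‖z‖ ^ 2) ^ 2 ≤ ‖Sᗮ.starProjection (toEuclideanLin Q z)‖ ^ 2 * ‖y‖ ^ 2 := by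
    rw [h6, ← mul_pow]
    refine sq_le_sq' ?_ (real_inner_le_norm _ _)
    linarith [neg_le_of_abs_le (abs_real_inner_le_norm (Sᗮ.starProjection (toEuclideanLin Q z)) y)]
  rcases eq_or_ne z 0 with rfl | hz0
  · simp
  have hZ : 0 < ‖z‖ ^ 2 := by positivity
  rw [div_mul_eq_mul_div, div_le_iff₀ hD]
  have hw2 : 0 < w ^ 2 := by positivity
  have h8 := h7.trans (mul_le_mul_of_nonneg_left hnormy (sq_nonneg _))
  rw [div_mul_eq_mul_div, ← mul_div_assoc, le_div_iff₀ hw2] at h8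
  refine le_of_mul_le_mul_left ?_ hZ
  nlinarith

/-- If a symmetric matrix `G` has quadratic form between `0` and `c`, then `G² ≤ c G`. -/
lemma norm_toEuclideanLin_sq_le_of_form {G : Matrix (Fin n) (Fin n) ℝ} (hG : Gᵀ = G) {c : ℝ}
    (h0 : ∀ v, 0 ≤ inner ℝ v (toEuclideanLin G v))
    (h1 : ∀ v, inner ℝ v (toEuclideanLin G v) ≤ c * ‖v‖ ^ 2) (v : EuclideanSpace ℝ (Fin n)) :
    ‖toEuclideanLin G v‖ ^ 2 ≤ c * inner ℝ v (toEuclideanLin G v) := by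
  -- Expand the form at `c' • v - G v`.
  have key : ∀ c' : ℝ, 0 ≤ c' ^ 2 * inner ℝ v (toEuclideanLin G v)
      - 2 * c' * ‖toEuclideanLin G v‖ ^ 2 + c * ‖toEuclideanLin G v‖ ^ 2 := by
    intro c'
    have h2 := h0 (c' • v - toEuclideanLin G v)
    have h3 := h1 (toEuclideanLin G v)
    have h4 : inner ℝ v (toEuclideanLin G (toEuclideanLin G v)) = ‖toEuclideanLin G v‖ ^ 2 := by
      have := inner_toEuclideanLin_left G v (toEuclideanLin G v)
      rw [hG] at this
      rw [← this, real_inner_self_eq_norm_sq]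
    simp only [map_sub, map_smul, inner_sub_left, inner_sub_right, inner_smul_left,
      inner_smul_right, conj_trivial, h4, real_inner_self_eq_norm_sq] at h2
    linarith
  by_cases hc : 0 < c
  · nlinarith [key c]
  · have h5 := h0 v
    have h6 := h1 v
    have h7 := key 1
    have h8 : c * ‖v‖ ^ 2 ≤ 0 := mul_nonpos_of_nonpos_of_nonneg (not_lt.1 hc) (sq_nonneg _)
    have h9 : inner ℝ v (toEuclideanLin G v) = 0 := le_antisymm (h6.trans h8) h5
    rw [h9] at h7 ⊢
    nlinarith [sq_nonneg ‖toEuclideanLin G v‖]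

/-- The block structure of a weight matrix, for a subspace `W` and a subspace `U` of the same
dimension whose vectors make an angle of sine at most `√t` with `W`. On a vector `Q u` of the image
the ratio `‖Q (Q u)‖² / ‖Q u‖²` increases with the sine of the angle between `u` and `W`, which
gives the first bound; the second one is `x² = 1 - w² / (w² (1 - t) + t)`, from the lower bound for
the last diagonal block. -/
lemma exists_isWeightBlock {r : ℕ} {U W : Submodule ℝ (EuclideanSpace ℝ (Fin n))}
    (hU : Module.finrank ℝ U = r) (hW : Module.finrank ℝ W = r)
    {w t : ℝ} (hw : 0 < w) (hw1 : w ≤ 1) (ht0 : 0 ≤ t) (ht1 : t ≤ 1)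
    (h : ∀ x ∈ U, ‖Wᗮ.starProjection x‖ ^ 2 ≤ t * ‖x‖ ^ 2) :
    ∃ S G, IsWeightBlock r (weightMatrix W w) (projMatrix U) S G
      √((w ^ 4 * (1 - t) + t) / (w ^ 2 * (1 - t) + t))
      √((1 - w ^ 2) * t / (w ^ 2 * (1 - t) + t)) := by
  set Q := weightMatrix W w with hQ
  set q := toEuclideanLin Q with hq
  set P := projMatrix U with hP
  set K := U.map q with hK
  set S := projMatrix K with hS
  set G := 1 - P - Q * (1 - S) * Q with hG
  have hD : 0 < w ^ 2 * (1 - t) + t := weight_denominator_pos hw hw1 ht0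
  have hw2 : w ^ 2 ≤ 1 := pow_le_one₀ hw.le hw1
  have hx0 : 0 ≤ (1 - w ^ 2) * t / (w ^ 2 * (1 - t) + t) :=
    div_nonneg (mul_nonneg (by linarith) ht0) hD.le
  have hx2 : (√((1 - w ^ 2) * t / (w ^ 2 * (1 - t) + t))) ^ 2
      = 1 - w ^ 2 / (w ^ 2 * (1 - t) + t) := by
    rw [Real.sq_sqrt hx0]
    field_simp
    ring
  have hQt : Qᵀ = Q := weightMatrix_transpose W w
  have hPt : Pᵀ = P := projMatrix_transpose U
  have hSt : Sᵀ = S := projMatrix_transpose K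
  have hqs : ∀ a b, inner ℝ (q a) b = inner ℝ a (q b) := by
    intro a b
    rw [hq, inner_toEuclideanLin_left, hQt]
  have hpythW : ∀ x, ‖x‖ ^ 2 = ‖W.starProjection x‖ ^ 2 + ‖Wᗮ.starProjection x‖ ^ 2 :=
    fun x => Submodule.norm_sq_eq_add_norm_sq_starProjection x W
  have hqnorm : ∀ x, ‖q x‖ ^ 2 = w ^ 2 * ‖W.starProjection x‖ ^ 2 + ‖Wᗮ.starProjection x‖ ^ 2 :=
    norm_toEuclideanLin_weightMatrix_sq W w
  have hqle : ∀ x, ‖q x‖ ^ 2 ≤ ‖x‖ ^ 2 := by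
    intro x
    rw [hqnorm, hpythW x]
    nlinarith [sq_nonneg ‖W.starProjection x‖]
  have hone_sub : ∀ (L : Submodule ℝ (EuclideanSpace ℝ (Fin n))) x,
      toEuclideanLin (1 - projMatrix L) x = Lᗮ.starProjection x := by
    intro L x
    rw [map_sub, LinearMap.sub_apply, toEuclideanLin_one_apply, toEuclideanLin_projMatrix,
      Submodule.starProjection_orthogonal_val]
  have hSQP : S * Q * P = Q * P := ext_toEuclideanLin fun x => by
    simp only [toEuclideanLin_mul_apply, hS, hP, toEuclideanLin_projMatrix]
    exact Submodule.starProjection_eq_self_iff.2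
      (Submodule.mem_map_of_mem (Submodule.starProjection_apply_mem U x))
  have hGt : Gᵀ = G := by
    simp only [hG, transpose_sub, transpose_one, transpose_mul, hQt, hPt, hSt, Matrix.mul_assoc]
  have hGP : G * P = 0 := by
    have h1 : (1 - S) * (Q * P) = 0 := by
      rw [Matrix.sub_mul, Matrix.one_mul, ← Matrix.mul_assoc, hSQP, sub_self]
    rw [hG, Matrix.sub_mul, Matrix.sub_mul, Matrix.one_mul, projMatrix_mul_self, sub_self,
      Matrix.mul_assoc, Matrix.mul_assoc, h1, Matrix.mul_zero, sub_zero]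
  -- The quadratic form of `G`.
  have hform : ∀ v, inner ℝ v (toEuclideanLin G v)
      = ‖Uᗮ.starProjection v‖ ^ 2 - ‖Kᗮ.starProjection (q (Uᗮ.starProjection v))‖ ^ 2 := by
    intro v
    have hself : ∀ (L : Submodule ℝ (EuclideanSpace ℝ (Fin n))) z,
        inner ℝ z (L.starProjection z) = ‖L.starProjection z‖ ^ 2 := by
      intro L z
      rw [← Submodule.starProjection_eq_self_iff.2 (Submodule.starProjection_apply_mem L z),
        ← Submodule.inner_starProjection_left_eq_right,
        Submodule.starProjection_eq_self_iff.2 (Submodule.starProjection_apply_mem L z),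
        real_inner_self_eq_norm_sq]
    have h1 : Kᗮ.starProjection (q v) = Kᗮ.starProjection (q (Uᗮ.starProjection v)) := by
      have h2 : v = U.starProjection v + Uᗮ.starProjection v :=
        (U.starProjection_add_starProjection_orthogonal v).symm
      have h3 : Kᗮ.starProjection (q (U.starProjection v)) = 0 := by
        rw [Submodule.starProjection_apply_eq_zero_iff, Submodule.orthogonal_orthogonal]
        exact Submodule.mem_map_of_mem (Submodule.starProjection_apply_mem U v)
      conv_lhs => rw [h2, map_add, map_add, h3, zero_add]
    rw [hG, map_sub, LinearMap.sub_apply, hone_sub, inner_sub_right, hself,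
      toEuclideanLin_mul_apply, toEuclideanLin_mul_apply, hone_sub, ← hq, ← hqs, hself, h1]
  have hlow : ∀ v, w ^ 2 / (w ^ 2 * (1 - t) + t) * ‖Uᗮ.starProjection v‖ ^ 2
      ≤ ‖Kᗮ.starProjection (q (Uᗮ.starProjection v))‖ ^ 2 := by
    intro v
    have hv := Submodule.starProjection_apply_mem Uᗮ v
    exact le_norm_orthogonal_image_sq hw hw1 ht0 hv
      (norm_starProjection_sq_le_of_mem_orthogonal (hU.trans hW.symm) ht0 h hv)
  have hproj : ∀ (L : Submodule ℝ (EuclideanSpace ℝ (Fin n))) z,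
      ‖L.starProjection z‖ ^ 2 ≤ ‖z‖ ^ 2 := fun L z =>
    pow_le_pow_left₀ (norm_nonneg _) (L.norm_starProjection_apply_le z) 2
  refine ⟨S, G, hQt, ?_, hPt, projMatrix_mul_self U, (rank_projMatrix U).trans_le hU.le, hSt,
    projMatrix_mul_self K, ?_, hSQP, ?_, ?_, hGt, ?_, hGP, ?_, ?_⟩
  · rw [opNorm_le_iff zero_le_one]
    intro x
    rw [one_mul]
    exact le_of_sq_le_sq (hqle x) (norm_nonneg _)
  · rw [rank_projMatrix]
    exact (Submodule.finrank_map_le q U).trans hU.le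
  · rw [← opNorm_transpose, transpose_mul, hQt, hSt, opNorm_le_iff (Real.sqrt_nonneg _)]
    intro x
    rw [toEuclideanLin_mul_apply, hS, toEuclideanLin_projMatrix, ← hq]
    obtain ⟨u, hu, hux⟩ := Submodule.starProjection_apply_mem K x
    refine le_of_sq_le_sq ?_ (by positivity)
    have ha0 : 0 ≤ (w ^ 4 * (1 - t) + t) / (w ^ 2 * (1 - t) + t) :=
      div_nonneg (add_nonneg (mul_nonneg (by positivity) (sub_nonneg.2 ht1)) ht0) hD.le
    rw [mul_pow, Real.sq_sqrt ha0]
    refine le_trans ?_ (mul_le_mul_of_nonneg_left (hproj K x) ha0)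
    rw [← hux, hqnorm, hqnorm]
    have h1 : W.starProjection (q u) = w • W.starProjection u :=
      starProjection_toEuclideanLin_weightMatrix W w u
    have h2 : Wᗮ.starProjection (q u) = Wᗮ.starProjection u :=
      starProjection_orthogonal_toEuclideanLin_weightMatrix W w u
    rw [h1, h2, norm_smul, mul_pow, Real.norm_eq_abs, sq_abs, div_mul_eq_mul_div, le_div_iff₀ hD]
    have h3 := h u hu
    rw [hpythW u] at h3
    generalize ‖W.starProjection u‖ ^ 2 = A at *
    generalize ‖Wᗮ.starProjection u‖ ^ 2 = B at *
    have h4 : 0 ≤ w ^ 2 * (1 - w ^ 2) * (t * (A + B) - B) :=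
      mul_nonneg (mul_nonneg (sq_nonneg w) (by linarith)) (by linarith)
    linarith
  · rw [opNorm_le_iff (Real.sqrt_nonneg _)]
    intro x
    rw [toEuclideanLin_mul_apply, toEuclideanLin_mul_apply, hP, hone_sub, hS,
      toEuclideanLin_projMatrix, ← hq]
    refine le_of_sq_le_sq ?_ (by positivity)
    rw [mul_pow, hx2]
    have h1 := Submodule.norm_sq_eq_add_norm_sq_starProjection (q (Uᗮ.starProjection x)) K
    have h2 := hlow x
    have h3 := hqle (Uᗮ.starProjection x)
    have h4 := hproj Uᗮ x
    have h5 := mul_le_mul_of_nonneg_left h4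
      (sq_nonneg √((1 - w ^ 2) * t / (w ^ 2 * (1 - t) + t)))
    rw [hx2] at h5
    linarith
  · rw [hG]
    abel
  · rw [rank_eq_finrank_range_toEuclideanLin]
    have hGs : ∀ a b, inner ℝ a (toEuclideanLin G b) = inner ℝ (toEuclideanLin G a) b := by
      intro a b
      rw [inner_toEuclideanLin_left, hGt]
    have h1 : LinearMap.range (toEuclideanLin G) ≤ Uᗮ ⊓ (U ⊔ W) := by
      rintro _ ⟨v, rfl⟩
      refine ⟨fun u hu => ?_, ?_⟩
      · have h2 : toEuclideanLin G u = 0 := by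
          have h3 : toEuclideanLin P u = u := by
            rw [hP, toEuclideanLin_projMatrix, Submodule.starProjection_eq_self_iff.2 hu]
          rw [← h3, ← toEuclideanLin_mul_apply, hGP]
          simp
        rw [hGs, h2, inner_zero_left]
      · rw [← Submodule.orthogonal_orthogonal (U ⊔ W)]
        intro z hz
        rw [Submodule.mem_orthogonal] at hz
        have hzU : z ∈ Uᗮ := fun u hu => hz u (Submodule.mem_sup_left hu)
        have hzW : z ∈ Wᗮ := fun u hu => hz u (Submodule.mem_sup_right hu)
        have hqz : q z = z := by
          rw [hq, hQ, toEuclideanLin_weightMatrix,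
            (Submodule.starProjection_apply_eq_zero_iff W).2 hzW,
            Submodule.starProjection_eq_self_iff.2 hzW, smul_zero, zero_add]
        have hzK : z ∈ Kᗮ := by
          rintro _ ⟨u, hu, rfl⟩
          rw [hqs, hqz]
          exact hzU u hu
        have h2 : toEuclideanLin G z = 0 := by
          rw [hG, map_sub, LinearMap.sub_apply, hone_sub, toEuclideanLin_mul_apply,
            toEuclideanLin_mul_apply, hone_sub, ← hq, hqz,
            Submodule.starProjection_eq_self_iff.2 hzK, hqz,
            Submodule.starProjection_eq_self_iff.2 hzU, sub_self]
        rw [hGs, h2, inner_zero_left]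
    have h2 := Submodule.finrank_mono h1
    have h3 := Submodule.finrank_add_inf_finrank_orthogonal (le_sup_left : U ≤ U ⊔ W)
    have h4 := Submodule.finrank_add_le_finrank_add_finrank U W
    omega
  · refine norm_toEuclideanLin_sq_le_of_form hGt (fun v => ?_) fun v => ?_
    · rw [hform]
      have h1 := (hproj Kᗮ (q (Uᗮ.starProjection v))).trans (hqle _)
      linarith
    · rw [hform]
      have h1 := hlow v
      have h4 := mul_le_mul_of_nonneg_left (hproj Uᗮ v)
        (sq_nonneg √((1 - w ^ 2) * t / (w ^ 2 * (1 - t) + t)))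
      rw [hx2] at h4 ⊢
      linarith

/-! ### An inequality between the constants -/

section constants

variable {x y : ℝ}

/-- The range where `α₂` decides. A linear function of `x + y` dominates the constant
`√((x² + x⁴) / 2 + y⁴)` and is small enough for the final bound even with `a b` replaced by `1`. -/
lemma one_add_gap_le_of_le_add (hx1 : x ≤ 1) (hy1 : y ≤ 1) (hs : 1.41 ≤ x + y) :
    (x ^ 2 + x ^ 4) / 2 + y ^ 4 ≤ (1.22 * (x + y) - 0.6432) ^ 2 ∧
      1 + (1.22 * (x + y) - 0.6432)
        ≤ 1.1 * (1 - (x * y + x ^ 2 + y ^ 2) / 30) * (1.414 * (x + y)) := by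
  have hx : 0.41 ≤ x := by linarith
  have hy : 0.41 ≤ y := by linarith
  have h0 : 0 ≤ (1 - x) * (1 - y) := mul_nonneg (sub_nonneg.2 hx1) (sub_nonneg.2 hy1)
  constructor
  · -- Chords of the convex function `z ↦ z ^ 2` on `[0.41 ^ 2, 1]`.
    have hchord : ∀ z : ℝ, 0.41 ≤ z → z ≤ 1 → z ^ 4 ≤ 1.1681 * z ^ 2 - 0.1681 := by
      intro z hz hz1
      have h1 : 0 ≤ z ^ 2 - 0.1681 := by nlinarith
      have h2 : 0 ≤ 1 - z ^ 2 := by nlinarith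
      nlinarith [mul_nonneg h1 h2]
    have h1 := hchord x hx hx1
    have h2 := hchord y hy hy1
    nlinarith
  · have h1 : x * y + x ^ 2 + y ^ 2 ≤ (x + y) ^ 2 - (x + y) + 1 := by nlinarith
    have h2 : x + y ≤ 2 := by linarith
    generalize x * y + x ^ 2 + y ^ 2 = q at *
    generalize x + y = s at *
    nlinarith [mul_nonneg (sub_nonneg.2 hs) (sub_nonneg.2 h2)]

/-- The range where `α₁` decides. With `h` replaced by a constant lower bound and `x ^ 4` by a
multiple of `x ^ 2`, the difference of the two sides is a quadratic function of `x`; where it is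
concave, it is compared with its values at the ends of the range of `x`. -/
lemma gap_sq_le_of_add_le {h : ℝ} (hx0 : 0 ≤ x) (hx1 : x ≤ 1) (hy0 : 0 ≤ y) (hy1 : y ≤ 1)
    (hs : x + y ≤ 1.41) (hh : h = 1.1 * (1 - (x * y + x ^ 2 + y ^ 2) / 30)) :
    (x ^ 2 + x ^ 4) / 2 + y ^ 4 ≤ (h * y + x * (h - y)) ^ 2 := by
  have hmono : ∀ {h₀ : ℝ}, 1 ≤ h₀ → h₀ ≤ h →
      (h₀ * y + x * (h₀ - y)) ^ 2 ≤ (h * y + x * (h - y)) ^ 2 := by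
    intro h₀ h1 h2
    have h3 : 0 ≤ x * (h₀ - y) := mul_nonneg hx0 (by linarith)
    have h4 : x * (h₀ - y) ≤ x * (h - y) := mul_le_mul_of_nonneg_left (by linarith) hx0
    have h5 : h₀ * y ≤ h * y := mul_le_mul_of_nonneg_right h2 hy0
    have h6 : 0 ≤ h₀ * y := by positivity
    exact pow_le_pow_left₀ (by linarith) (by linarith) 2
  have hx4 : x ^ 4 ≤ x ^ 2 := pow_le_pow_of_le_one hx0 hx1 (by norm_num)
  have hxy : 0 ≤ x * y := mul_nonneg hx0 hy0
  have hX : 0 ≤ 1.41 - y - x := by linarith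
  rcases le_total y 0.9 with hy9 | hy9
  · have h1 : 1.027 ≤ h := by nlinarith
    refine le_trans ?_ (hmono (by norm_num) h1)
    suffices x ^ 2 + y ^ 4 ≤ (1.027 * y + x * (1.027 - y)) ^ 2 by linarith
    have hF0 : 0 ≤ 1.027 ^ 2 * y ^ 2 - y ^ 4 := by
      have : y ^ 4 ≤ y ^ 2 := pow_le_pow_of_le_one hy0 hy1 (by norm_num)
      nlinarith [sq_nonneg y]
    rcases le_total y 0.027 with hy2 | hy2
    · have h2 : 1 ≤ (1.027 - y) ^ 2 := by nlinarith
      have h3 : 0 ≤ x * y * (1.027 - y) := mul_nonneg hxy (by linarith)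
      nlinarith [mul_le_mul_of_nonneg_left h2 (sq_nonneg x)]
    have hconc : 0 ≤ 1 - (1.027 - y) ^ 2 := by nlinarith
    rcases le_total y 0.41 with hy4 | hy4
    · have hF1 : 0 ≤ (1.027 + 0.027 * y) ^ 2 - 1 - y ^ 4 := by
        have h2 : y ^ 2 ≤ 0.1681 := by nlinarith
        have h3 : y ^ 4 ≤ 0.1681 * 0.1681 := by
          calc y ^ 4 = y ^ 2 * y ^ 2 := by ring
            _ ≤ _ := mul_le_mul h2 h2 (sq_nonneg y) (by norm_num)
        nlinarith
      have h2 := mul_nonneg (sub_nonneg.2 hx1) hF0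
      have h3 := mul_nonneg hx0 hF1
      have h4 := mul_nonneg (mul_nonneg hx0 (sub_nonneg.2 hx1)) hconc
      linarith
    · have hF1 : 0 ≤ (1.027 * y + (1.41 - y) * (1.027 - y)) ^ 2 - (1.41 - y) ^ 2 - y ^ 4 := by
        nlinarith [mul_nonneg (sub_nonneg.2 hy4) (sub_nonneg.2 hy9),
          mul_nonneg (mul_nonneg (sub_nonneg.2 hy4) (sub_nonneg.2 hy9)) hy0]
      have hXpos : 0 < 1.41 - y := by linarith
      have h2 := mul_nonneg hX hF0
      have h3 := mul_nonneg hx0 hF1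
      have h4 := mul_nonneg (mul_nonneg (mul_nonneg hx0 hXpos.le) hX) hconc
      have h5 : 0 ≤ (1.41 - y) * ((1.027 * y + x * (1.027 - y)) ^ 2 - x ^ 2 - y ^ 4) := by
        linarith
      linarith [nonneg_of_mul_nonneg_right h5 hXpos]
  · have h1 : 1.042 ≤ h := by nlinarith [mul_nonneg (sub_nonneg.2 hy9) hX]
    refine le_trans ?_ (hmono (by norm_num) h1)
    have hx2 : x ^ 4 ≤ 0.2601 * x ^ 2 := by
      have h2 : x ^ 2 ≤ 0.2601 := by nlinarith
      nlinarith [mul_le_mul_of_nonneg_left h2 (sq_nonneg x)]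
    suffices 0.63005 * x ^ 2 + y ^ 4 ≤ (1.042 * y + x * (1.042 - y)) ^ 2 by linarith
    have hF0 : 0 ≤ 1.042 ^ 2 * y ^ 2 - y ^ 4 := by
      have : y ^ 4 ≤ y ^ 2 := pow_le_pow_of_le_one hy0 hy1 (by norm_num)
      nlinarith [sq_nonneg y]
    have hconc : 0 ≤ 0.63005 - (1.042 - y) ^ 2 := by nlinarith
    have hF1 : 0 ≤ (1.042 * y + (1.41 - y) * (1.042 - y)) ^ 2 - 0.63005 * (1.41 - y) ^ 2
        - y ^ 4 := by
      nlinarith [mul_nonneg (sub_nonneg.2 hy9) (sub_nonneg.2 hy1),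
        mul_nonneg (mul_nonneg (sub_nonneg.2 hy9) (sub_nonneg.2 hy1)) hy0]
    have hXpos : 0 < 1.41 - y := by linarith
    have h2 := mul_nonneg hX hF0
    have h3 := mul_nonneg hx0 hF1
    have h4 := mul_nonneg (mul_nonneg (mul_nonneg hx0 hXpos.le) hX) hconc
    have h5 : 0 ≤ (1.41 - y) * ((1.042 * y + x * (1.042 - y)) ^ 2 - 0.63005 * x ^ 2 - y ^ 4) := by
      linarith
    linarith [nonneg_of_mul_nonneg_right h5 hXpos]

/-- The constant in the bound for the nuclear norm of the error off the tangent space, compared with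
`max α₁ α₂`. -/
lemma mul_add_gap_le {a b g m : ℝ} (hx0 : 0 ≤ x) (hy0 : 0 ≤ y) (hxa : x ≤ a) (hyb : y ≤ b)
    (ha : a ≤ 1) (hb : b ≤ 1) (hg : g = √((x ^ 2 + x ^ 4) / 2 + y ^ 4))
    (hm1 : a + b ≤ m) (hm2 : √2 * (x + y) ≤ m) :
    a * b + g ≤ 1.1 * (1 - (x * y + x ^ 2 + y ^ 2) / 30) * m := by
  have hx1 := hxa.trans ha
  have hy1 := hyb.trans hb
  set h := 1.1 * (1 - (x * y + x ^ 2 + y ^ 2) / 30) with hh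
  have hh0 : 0 ≤ h := by nlinarith [mul_le_one₀ hx1 hy0 hy1]
  rcases le_total (x + y) 1.41 with hs | hs
  · have h1 : 1 ≤ h := by nlinarith [mul_nonneg hx0 hy0]
    have h2 : g ≤ h * y + x * (h - y) := by
      rw [hg]
      refine Real.sqrt_le_iff.2 ⟨?_, gap_sq_le_of_add_le hx0 hx1 hy0 hy1 hs hh⟩
      have : 0 ≤ x * (h - y) := mul_nonneg hx0 (by linarith)
      positivity
    -- `h (a + b) - a b` is increasing in `a` and in `b`.
    have h3 : 0 ≤ (a - x) * (h - b) := mul_nonneg (by linarith) (by linarith)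
    have h4 : 0 ≤ (b - y) * (h - x) := mul_nonneg (by linarith) (by linarith)
    have h5 := mul_le_mul_of_nonneg_left hm1 hh0
    linarith
  · obtain ⟨h1, h2⟩ := one_add_gap_le_of_le_add hx1 hy1 hs
    rw [← hh] at h2
    have h3 : g ≤ 1.22 * (x + y) - 0.6432 := by
      rw [hg]
      exact Real.sqrt_le_iff.2 ⟨by linarith, h1⟩
    have h4 : a * b ≤ 1 := mul_le_one₀ ha (hy0.trans hyb) hb
    have h5 : 1.414 ≤ √2 := Real.le_sqrt_of_sq_le (by norm_num)
    have h6 : 1.414 * (x + y) ≤ m :=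
      (mul_le_mul_of_nonneg_right h5 (by linarith)).trans hm2
    have h7 := mul_le_mul_of_nonneg_left h6 hh0
    linarith

end constants

/-! ### The gap matrix -/

section blocks

variable {r : ℕ} {Q P S G Q' P' S' G' : Matrix (Fin n) (Fin n) ℝ} {a b x y : ℝ}

lemma one_sub_transpose {A : Matrix (Fin n) (Fin n) ℝ} (hA : Aᵀ = A) : (1 - A)ᵀ = 1 - A := by
  rw [transpose_sub, transpose_one, hA]

lemma one_sub_mul_self {A : Matrix (Fin n) (Fin n) ℝ} (hA : A * A = A) :
    (1 - A) * (1 - A) = 1 - A := by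
  rw [Matrix.mul_sub, Matrix.mul_one, Matrix.sub_mul, Matrix.one_mul, hA, sub_self, sub_zero]

lemma opNorm_proj_le {A : Matrix (Fin n) (Fin n) ℝ} (hA : Aᵀ = A) (hAA : A * A = A) :
    opNorm A ≤ 1 := by
  have h := opNorm_transpose_mul_self A
  rw [hA, hAA] at h
  nlinarith [opNorm_nonneg A]

namespace IsWeightBlock

lemma inner_gap_nonneg (h : IsWeightBlock r Q P S G a x) (v : EuclideanSpace ℝ (Fin n)) :
    0 ≤ inner ℝ v (toEuclideanLin G v) := by
  have h1 := h.norm_gap_sq_le v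
  by_contra! h2
  have h3 : x ^ 2 * inner ℝ v (toEuclideanLin G v) ≤ 0 :=
    mul_nonpos_of_nonneg_of_nonpos (sq_nonneg x) h2.le
  have h4 : ‖toEuclideanLin G v‖ = 0 := by nlinarith [norm_nonneg (toEuclideanLin G v)]
  rw [norm_eq_zero.1 h4, inner_zero_right] at h2
  exact lt_irrefl _ h2

lemma norm_one_sub_gap_sq (v : EuclideanSpace ℝ (Fin n)) :
    ‖toEuclideanLin (1 - G) v‖ ^ 2
      = ‖v‖ ^ 2 - 2 * inner ℝ v (toEuclideanLin G v) + ‖toEuclideanLin G v‖ ^ 2 := by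
  rw [map_sub, LinearMap.sub_apply, toEuclideanLin_one_apply, norm_sub_sq_real]

lemma opNorm_gap_le (h : IsWeightBlock r Q P S G a x) : opNorm G ≤ x ^ 2 := by
  rw [opNorm_le_iff (sq_nonneg x)]
  intro v
  have h1 := h.norm_gap_sq_le v
  have h2 := mul_le_mul_of_nonneg_left (real_inner_le_norm v (toEuclideanLin G v)) (sq_nonneg x)
  rcases eq_or_ne ‖toEuclideanLin G v‖ 0 with h0 | h0
  · rw [h0]
    positivity
  · have h3 : 0 < ‖toEuclideanLin G v‖ := lt_of_le_of_ne (norm_nonneg _) (Ne.symm h0)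
    refine le_of_mul_le_mul_right ?_ h3
    linarith

lemma opNorm_one_sub_gap_le (h : IsWeightBlock r Q P S G a x) (hx : x ^ 2 ≤ 1) :
    opNorm (1 - G) ≤ 1 := by
  rw [opNorm_le_iff zero_le_one]
  intro v
  rw [one_mul]
  refine le_of_sq_le_sq ?_ (norm_nonneg _)
  rw [norm_one_sub_gap_sq]
  have h1 := h.norm_gap_sq_le v
  have h2 := h.inner_gap_nonneg v
  nlinarith

/-- The Frobenius norm form of `(1 - G)² + (2 x⁻² - 1) G² ≤ 1`. -/
lemma norm_gap_mul_sq_le (h : IsWeightBlock r Q P S G a x) (T : Matrix (Fin n) (Fin n) ℝ) :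
    x ^ 2 * ‖(1 - G) * T‖ ^ 2 + (2 - x ^ 2) * ‖G * T‖ ^ 2 ≤ x ^ 2 * ‖T‖ ^ 2 := by
  rw [norm_sq_eq_sum_col, norm_sq_eq_sum_col (G * T), norm_sq_eq_sum_col T, Finset.mul_sum,
    Finset.mul_sum, Finset.mul_sum, ← Finset.sum_add_distrib]
  refine Finset.sum_le_sum fun j _ => ?_
  have h1 := norm_one_sub_gap_sq (G := G) (WithLp.toLp 2 (T.col j))
  have h2 := h.norm_gap_sq_le (WithLp.toLp 2 (T.col j))
  change x ^ 2 * ‖toEuclideanLin (1 - G) (WithLp.toLp 2 (T.col j))‖ ^ 2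
    + (2 - x ^ 2) * ‖toEuclideanLin G (WithLp.toLp 2 (T.col j))‖ ^ 2 ≤ _
  rw [h1]
  linarith

/-- The left factor `G` has norm at most `x²` and the right factor `G'` at most `y²`, but the parts
of `T` on which both are large compete: Cauchy–Schwarz improves `x² + y²` to a Euclidean sum. -/
lemma norm_gap_add_norm_gap_le (h : IsWeightBlock r Q P S G a x)
    (h' : IsWeightBlock r Q' P' S' G' b y) (hx : x ^ 2 ≤ 1) (T : Matrix (Fin n) (Fin n) ℝ) :
    ‖G * T‖ + ‖(1 - G) * T * G'‖ ≤ √((x ^ 2 + x ^ 4) / 2 + y ^ 4) * ‖T‖ := by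
  have h1 : ‖(1 - G) * T * G'‖ ≤ y ^ 2 * ‖(1 - G) * T‖ := by
    refine (norm_mul_le_mul_opNorm _ _).trans ?_
    rw [mul_comm]
    exact mul_le_mul_of_nonneg_right h'.opNorm_gap_le (norm_nonneg _)
  have h2 := h.norm_gap_mul_sq_le T
  have h3 : ‖(1 - G) * T‖ ≤ ‖T‖ := by
    refine (norm_mul_le_opNorm_mul _ _).trans ?_
    exact mul_le_of_le_one_left (norm_nonneg _) (h.opNorm_one_sub_gap_le hx)
  have hA := norm_nonneg (G * T)
  have hB := norm_nonneg ((1 - G) * T)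
  have hN := norm_nonneg T
  suffices ‖G * T‖ + y ^ 2 * ‖(1 - G) * T‖ ≤ √((x ^ 2 + x ^ 4) / 2 + y ^ 4) * ‖T‖ by linarith
  generalize ‖G * T‖ = A at *
  generalize ‖(1 - G) * T‖ = B at *
  generalize ‖T‖ = N at *
  refine le_of_sq_le_sq ?_ (by positivity)
  rw [mul_pow, Real.sq_sqrt (by positivity)]
  rcases eq_or_ne x 0 with rfl | hx0
  · have h4 : A = 0 := by nlinarith
    rw [h4]
    have h5 := mul_le_mul_of_nonneg_left (pow_le_pow_left₀ hB h3 2) (sq_nonneg (y ^ 2))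
    linarith
  · have hx2 : 0 < x ^ 2 := by positivity
    set c := (x ^ 2 + x ^ 4) / 2 with hc
    have hc0 : 0 < c := by positivity
    have h4 : A ^ 2 + c * B ^ 2 ≤ c * N ^ 2 := by
      have h5 := mul_le_mul_of_nonneg_left h2 (show 0 ≤ (1 + x ^ 2) / 2 by positivity)
      have h6 : 0 ≤ x ^ 2 * (1 - x ^ 2) * A ^ 2 := by
        have : 0 ≤ 1 - x ^ 2 := by linarith
        positivity
      rw [hc]
      linarith
    refine le_of_mul_le_mul_left ?_ hc0
    have h5 := mul_le_mul_of_nonneg_left h4 (show 0 ≤ c + y ^ 4 by positivity)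
    linarith [sq_nonneg (y ^ 2 * A - c * B)]

end IsWeightBlock

/-! ### The cone condition -/

/-- The cone condition: optimality of `M + H` bounds the last diagonal block of `Q H Q'` by the
first one and the part of `M` off `Mr`. The off-diagonal blocks do not enter. -/
lemma nuclearNorm_last_block_le (h : IsWeightBlock r Q P S G a x)
    (h' : IsWeightBlock r Q' P' S' G' b y) {M Mr H : Matrix (Fin n) (Fin n) ℝ}
    (hMr : P * Mr = Mr) (hMr' : Mr * P' = Mr)
    (hopt : nuclearNorm (Q * (M + H) * Q') ≤ nuclearNorm (Q * M * Q')) :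
    nuclearNorm ((1 - S) * (Q * H * Q') * (1 - S'))
      ≤ nuclearNorm (S * (Q * H * Q') * S') + 2 * nuclearNorm (M - Mr) := by
  have hPQ' : P' * Q' * S' = P' * Q' := by
    have := congrArg transpose h'.image_mul_weight_mul
    simpa only [transpose_mul, h'.transpose_weight, h'.transpose_proj, h'.transpose_image,
      Matrix.mul_assoc] using this
  have h1 : S * (Q * Mr * Q') * S' = Q * Mr * Q' := by
    calc _ = (S * Q * P) * Mr * (P' * Q' * S') := by
          conv_lhs => rw [← hMr, ← hMr']
          simp only [Matrix.mul_assoc]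
      _ = Q * (P * Mr * P') * Q' := by
          rw [h.image_mul_weight_mul, hPQ']
          simp only [Matrix.mul_assoc]
      _ = _ := by rw [hMr, hMr']
  have h2 : (1 - S) * (Q * Mr * Q') * (1 - S') = 0 := by
    have : (1 - S) * (Q * Mr * Q') = 0 := by
      generalize Q * Mr * Q' = X at h1
      rw [Matrix.sub_mul, Matrix.one_mul, sub_eq_zero, ← h1, Matrix.mul_assoc,
        ← Matrix.mul_assoc S S, h.image_mul_self]
    rw [this, Matrix.zero_mul]
  have h3 : nuclearNorm (Q * (M - Mr) * Q') ≤ nuclearNorm (M - Mr) := by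
    refine (nuclearNorm_mul_mul_le _ _ _).trans ?_
    have hQ := h.opNorm_weight_le
    have hQ' := h'.opNorm_weight_le
    have h0 := nuclearNorm_nonneg (M - Mr)
    calc _ ≤ 1 * nuclearNorm (M - Mr) * 1 :=
          mul_le_mul (mul_le_mul_of_nonneg_right hQ h0) hQ' (opNorm_nonneg _) (by linarith)
      _ = _ := by ring
  have h4 := nuclearNorm_pinching h.transpose_image h.image_mul_self h'.transpose_image
    h'.image_mul_self (Q * (Mr + H) * Q')
  have h5 : (1 - S) * (Q * (Mr + H) * Q') * (1 - S') = (1 - S) * (Q * H * Q') * (1 - S') := by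
    rw [Matrix.mul_add, Matrix.add_mul, Matrix.mul_add, Matrix.add_mul, h2, zero_add]
  have h6 : nuclearNorm (Q * Mr * Q')
      ≤ nuclearNorm (S * (Q * (Mr + H) * Q') * S') + nuclearNorm (S * (Q * H * Q') * S') := by
    have h7 : Q * Mr * Q' = S * (Q * (Mr + H) * Q') * S' + -(S * (Q * H * Q') * S') := by
      rw [Matrix.mul_add, Matrix.add_mul, Matrix.mul_add, Matrix.add_mul, h1, add_neg_cancel_right]
    have h8 := nuclearNorm_add_le (S * (Q * (Mr + H) * Q') * S') (-(S * (Q * H * Q') * S'))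
    rwa [← h7, nuclearNorm_neg] at h8
  have h7 : nuclearNorm (Q * (Mr + H) * Q')
      ≤ nuclearNorm (Q * (M + H) * Q') + nuclearNorm (Q * (M - Mr) * Q') := by
    have h8 : Q * (Mr + H) * Q' = Q * (M + H) * Q' + -(Q * (M - Mr) * Q') := by
      noncomm_ring
    have h9 := nuclearNorm_add_le (Q * (M + H) * Q') (-(Q * (M - Mr) * Q'))
    rwa [← h8, nuclearNorm_neg] at h9
  have h8 : nuclearNorm (Q * M * Q')
      ≤ nuclearNorm (Q * Mr * Q') + nuclearNorm (Q * (M - Mr) * Q') := by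
    have h9 : Q * M * Q' = Q * Mr * Q' + Q * (M - Mr) * Q' := by
      noncomm_ring
    rw [h9]
    exact nuclearNorm_add_le _ _
  rw [h5] at h4
  linarith

/-- The error off the tangent space in terms of its last weighted block: `Q (1 - S)` inverts
`(1 - S) Q` up to `G`. -/
lemma nuclearNorm_offTangent_le (h : IsWeightBlock r Q P S G a x)
    (h' : IsWeightBlock r Q' P' S' G' b y) (H : Matrix (Fin n) (Fin n) ℝ) :
    nuclearNorm ((1 - P) * H * (1 - P'))
      ≤ nuclearNorm ((1 - S) * (Q * H * Q') * (1 - S'))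
        + nuclearNorm (G * ((1 - P) * H * (1 - P')) + (1 - G) * ((1 - P) * H * (1 - P')) * G') := by
  have hS : (1 - S) * Q * P = 0 := by
    rw [Matrix.sub_mul, Matrix.one_mul, Matrix.sub_mul, h.image_mul_weight_mul, sub_self]
  have hS' : P' * (Q' * (1 - S')) = 0 := by
    have h1 : (1 - S') * Q' * P' = 0 := by
      rw [Matrix.sub_mul, Matrix.one_mul, Matrix.sub_mul, h'.image_mul_weight_mul, sub_self]
    have := congrArg transpose h1
    simpa only [transpose_mul, h'.transpose_weight, h'.transpose_proj,
      one_sub_transpose h'.transpose_image, transpose_zero, Matrix.mul_assoc] using this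
  have hG : (1 - G) * (1 - P) = Q * (1 - S) * Q := by
    rw [h.weight_mul_weight, Matrix.mul_sub, Matrix.mul_one, Matrix.sub_mul, Matrix.one_mul,
      h.gap_mul_proj]
    abel
  have hG' : (1 - P') * (1 - G') = Q' * (1 - S') * Q' := by
    have h1 : P' * G' = 0 := by
      have := congrArg transpose h'.gap_mul_proj
      simpa only [transpose_mul, h'.transpose_proj, h'.transpose_gap, transpose_zero] using this
    rw [h'.weight_mul_weight, Matrix.mul_sub, Matrix.mul_one, Matrix.sub_mul, Matrix.one_mul, h1]
    abel
  have hSS := one_sub_mul_self h.image_mul_self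
  have hSS' := one_sub_mul_self h'.image_mul_self
  have h1 : (1 - G) * ((1 - P) * H * (1 - P')) * (1 - G')
      = (Q * (1 - S)) * ((1 - S) * (Q * H * Q') * (1 - S')) * ((1 - S') * Q') := by
    calc _ = ((1 - G) * (1 - P)) * H * ((1 - P') * (1 - G')) := by simp only [Matrix.mul_assoc]
      _ = (Q * ((1 - S) * (1 - S)) * Q) * H * (Q' * ((1 - S') * (1 - S')) * Q') := by
          rw [hG, hG', hSS, hSS']
      _ = _ := by simp only [Matrix.mul_assoc]
  have hop : opNorm (Q * (1 - S)) ≤ 1 := (opNorm_mul_le _ _).trans <|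
    mul_le_one₀ h.opNorm_weight_le (opNorm_nonneg _)
      (opNorm_proj_le (one_sub_transpose h.transpose_image) hSS)
  have hop' : opNorm ((1 - S') * Q') ≤ 1 := (opNorm_mul_le _ _).trans <|
    mul_le_one₀ (opNorm_proj_le (one_sub_transpose h'.transpose_image) hSS') (opNorm_nonneg _)
      h'.opNorm_weight_le
  have h2 : nuclearNorm ((1 - G) * ((1 - P) * H * (1 - P')) * (1 - G'))
      ≤ nuclearNorm ((1 - S) * (Q * H * Q') * (1 - S')) := by
    rw [h1]
    refine (nuclearNorm_mul_mul_le _ _ _).trans ?_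
    have h0 := nuclearNorm_nonneg ((1 - S) * (Q * H * Q') * (1 - S'))
    calc _ ≤ 1 * nuclearNorm ((1 - S) * (Q * H * Q') * (1 - S')) * 1 :=
          mul_le_mul (mul_le_mul_of_nonneg_right hop h0) hop' (opNorm_nonneg _) (by linarith)
      _ = _ := by ring
  generalize hH : (1 - P) * H * (1 - P') = K at *
  have h3 : K = (1 - G) * K * (1 - G') + (G * K + (1 - G) * K * G') := by noncomm_ring
  calc nuclearNorm K
      = nuclearNorm ((1 - G) * K * (1 - G') + (G * K + (1 - G) * K * G')) := by rw [← h3]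
    _ ≤ _ := nuclearNorm_add_le _ _
    _ ≤ _ := by linarith

/-- The cone condition in terms of a splitting of the error `H` into a head and a tail `T` off the
tangent space: the head enters through its Frobenius norm, the tail through its operator norm. -/
lemma nuclearNorm_offTangent_le_of_split (h : IsWeightBlock r Q P S G a x)
    (h' : IsWeightBlock r Q' P' S' G' b y) (ha : 0 ≤ a) (hx0 : 0 ≤ x)
    (hx : x ^ 2 ≤ 1) {M Mr H T₀ T : Matrix (Fin n) (Fin n) ℝ}
    (hMr : P * Mr = Mr) (hMr' : Mr * P' = Mr)
    (hopt : nuclearNorm (Q * (M + H) * Q') ≤ nuclearNorm (Q * M * Q'))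
    (hsplit : (1 - P) * H * (1 - P') = T₀ + T) (hPT : P * T = 0) (hTP : T * P' = 0) :
    nuclearNorm ((1 - P) * H * (1 - P'))
      ≤ √r * (a * b + √((x ^ 2 + x ^ 4) / 2 + y ^ 4)) * ‖H - T‖
        + r * (x * y + x ^ 2 + y ^ 2) * opNorm T + 2 * nuclearNorm (M - Mr) := by
  have hT : (1 - P) * T * (1 - P') = T := by
    rw [Matrix.sub_mul, Matrix.one_mul, hPT, sub_zero, Matrix.mul_sub, Matrix.mul_one, hTP,
      sub_zero]
  have hr := Real.sqrt_nonneg (r : ℝ)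
  have hT₀ : ‖T₀‖ ≤ ‖H - T‖ := by
    have h1 : T₀ = (1 - P) * (H - T) * (1 - P') := by
      rw [Matrix.mul_sub (1 - P) H T, Matrix.sub_mul _ _ (1 - P'), hT, hsplit, add_sub_cancel_right]
    rw [h1]
    have h2 := opNorm_proj_le (one_sub_transpose h.transpose_proj)
      (one_sub_mul_self h.proj_mul_self)
    have h3 := opNorm_proj_le (one_sub_transpose h'.transpose_proj)
      (one_sub_mul_self h'.proj_mul_self)
    exact (norm_mul_le_mul_opNorm _ _).trans <|
      (mul_le_of_le_one_right (norm_nonneg _) h3).trans <|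
      (norm_mul_le_opNorm_mul _ _).trans (mul_le_of_le_one_left (norm_nonneg _) h2)
  have hQS' : opNorm (Q' * S') ≤ b := by
    rw [← opNorm_transpose, transpose_mul, h'.transpose_weight, h'.transpose_image]
    exact h'.opNorm_image_mul_weight_le
  have hoff' : opNorm ((1 - P') * Q' * S') ≤ y := by
    rw [← opNorm_transpose, transpose_mul, transpose_mul, h'.transpose_weight, h'.transpose_image,
      one_sub_transpose h'.transpose_proj, ← Matrix.mul_assoc]
    exact h'.opNorm_offDiag_le
  have hfirst_head : nuclearNorm (S * (Q * (H - T) * Q') * S') ≤ √r * (a * b * ‖H - T‖) := by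
    have h1 : S * (Q * (H - T) * Q') * S' = S * Q * (H - T) * (Q' * S') := by
      simp only [Matrix.mul_assoc]
    have hrank : (S * (Q * (H - T) * Q') * S').rank ≤ r :=
      (rank_mul_le_left _ _).trans ((rank_mul_le_left _ _).trans h.rank_image_le)
    refine (nuclearNorm_le_sqrt_mul_norm _ hrank).trans (mul_le_mul_of_nonneg_left ?_ hr)
    rw [h1]
    calc _ ≤ ‖S * Q * (H - T)‖ * opNorm (Q' * S') := norm_mul_le_mul_opNorm _ _
      _ ≤ (a * ‖H - T‖) * b := by
          refine mul_le_mul ?_ hQS' (opNorm_nonneg _) (by positivity)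
          exact (norm_mul_le_opNorm_mul _ _).trans
            (mul_le_mul_of_nonneg_right h.opNorm_image_mul_weight_le (norm_nonneg _))
      _ = _ := by ring
  have hfirst_tail : nuclearNorm (S * (Q * T * Q') * S') ≤ r * (x * y * opNorm T) := by
    have h1 : S * (Q * T * Q') * S' = S * Q * (1 - P) * T * ((1 - P') * Q' * S') := by
      conv_lhs => rw [← hT]
      simp only [Matrix.mul_assoc]
    have hrank : (S * (Q * T * Q') * S').rank ≤ r :=
      (rank_mul_le_left _ _).trans ((rank_mul_le_left _ _).trans h.rank_image_le)
    refine (nuclearNorm_le_mul_opNorm _ hrank).trans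
      (mul_le_mul_of_nonneg_left ?_ (Nat.cast_nonneg r))
    rw [h1]
    calc _ ≤ opNorm (S * Q * (1 - P) * T) * opNorm ((1 - P') * Q' * S') := opNorm_mul_le _ _
      _ ≤ (x * opNorm T) * y := by
          refine mul_le_mul ?_ hoff' (opNorm_nonneg _) (mul_nonneg hx0 (opNorm_nonneg _))
          exact (opNorm_mul_le _ _).trans
            (mul_le_mul_of_nonneg_right h.opNorm_offDiag_le (opNorm_nonneg _))
      _ = _ := by ring
  have hrankL : ∀ K, (G * K).rank ≤ r := fun K => (rank_mul_le_left _ _).trans h.rank_gap_le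
  have hrankR : ∀ K, (K * G').rank ≤ r := fun K => (rank_mul_le_right _ _).trans h'.rank_gap_le
  have hgap_head : nuclearNorm (G * T₀ + (1 - G) * T₀ * G')
      ≤ √r * (√((x ^ 2 + x ^ 4) / 2 + y ^ 4) * ‖H - T‖) := by
    refine (nuclearNorm_add_le _ _).trans ?_
    have h1 := nuclearNorm_le_sqrt_mul_norm _ (hrankL T₀)
    have h2 := nuclearNorm_le_sqrt_mul_norm _ (hrankR ((1 - G) * T₀))
    have h3 := mul_le_mul_of_nonneg_left (h.norm_gap_add_norm_gap_le h' hx T₀) hr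
    have h4 := mul_le_mul_of_nonneg_left hT₀ (Real.sqrt_nonneg ((x ^ 2 + x ^ 4) / 2 + y ^ 4))
    have h5 := mul_le_mul_of_nonneg_left h4 hr
    linarith
  have hgap_tail : nuclearNorm (G * T + (1 - G) * T * G') ≤ r * ((x ^ 2 + y ^ 2) * opNorm T) := by
    refine (nuclearNorm_add_le _ _).trans ?_
    have h1 := nuclearNorm_le_mul_opNorm _ (hrankL T)
    have h2 := nuclearNorm_le_mul_opNorm _ (hrankR ((1 - G) * T))
    have h3 : opNorm (G * T) ≤ x ^ 2 * opNorm T := (opNorm_mul_le _ _).trans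
      (mul_le_mul_of_nonneg_right h.opNorm_gap_le (opNorm_nonneg _))
    have h4 : opNorm ((1 - G) * T * G') ≤ opNorm T * y ^ 2 := by
      refine (opNorm_mul_le _ _).trans
        (mul_le_mul ?_ h'.opNorm_gap_le (opNorm_nonneg _) (opNorm_nonneg _))
      exact (opNorm_mul_le _ _).trans
        (mul_le_of_le_one_left (opNorm_nonneg _) (h.opNorm_one_sub_gap_le hx))
    have h5 := mul_le_mul_of_nonneg_left (add_le_add h3 h4) (Nat.cast_nonneg (α := ℝ) r)
    linarith
  have hfirst : nuclearNorm (S * (Q * H * Q') * S')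
      ≤ nuclearNorm (S * (Q * (H - T) * Q') * S') + nuclearNorm (S * (Q * T * Q') * S') := by
    have h1 : S * (Q * H * Q') * S' = S * (Q * (H - T) * Q') * S' + S * (Q * T * Q') * S' := by
      noncomm_ring
    rw [h1]
    exact nuclearNorm_add_le _ _
  have hgap : nuclearNorm (G * (T₀ + T) + (1 - G) * (T₀ + T) * G')
      ≤ nuclearNorm (G * T₀ + (1 - G) * T₀ * G') + nuclearNorm (G * T + (1 - G) * T * G') := by
    have h1 : G * (T₀ + T) + (1 - G) * (T₀ + T) * G'
        = (G * T₀ + (1 - G) * T₀ * G') + (G * T + (1 - G) * T * G') := by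
      noncomm_ring
    rw [h1]
    exact nuclearNorm_add_le _ _
  have hcone := nuclearNorm_last_block_le h h' hMr hMr' hopt
  have hmain := nuclearNorm_offTangent_le h h' H
  rw [hsplit] at hmain ⊢
  linarith

end blocks

/-! ### Weight blocks of a rank truncation -/

lemma rank_add_le_rank_add_rank (A B : Matrix (Fin n) (Fin n) ℝ) :
    (A + B).rank ≤ A.rank + B.rank := by
  simp only [rank_eq_finrank_range_toEuclideanLin]
  refine (Submodule.finrank_mono ?_).trans (Submodule.finrank_add_le_finrank_add_finrank _ _)
  rintro _ ⟨x, rfl⟩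
  rw [map_add, LinearMap.add_apply]
  exact Submodule.add_mem_sup (LinearMap.mem_range_self _ x) (LinearMap.mem_range_self _ x)

lemma rank_le_of_isRankTruncation {r : ℕ} {M Mr : Matrix (Fin n) (Fin n) ℝ}
    (h : IsRankTruncation r M Mr) : Mr.rank ≤ r := by
  obtain ⟨U, -, V, -, σ, -, -, -, rfl⟩ := h
  refine (rank_mul_le_left _ _).trans ((rank_mul_le_right _ _).trans ?_)
  rw [rank_diagonal, Fintype.card_subtype]
  have h1 : ((Finset.univ.filter fun i : Fin n => (if (i : ℕ) < r then σ i else 0) ≠ 0).map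
      Fin.valEmbedding) ⊆ Finset.range r := by
    intro i hi
    simp only [Finset.mem_map, Finset.mem_filter, Fin.valEmbedding_apply] at hi
    obtain ⟨j, ⟨-, hj⟩, rfl⟩ := hi
    rw [Finset.mem_range]
    by_contra h2
    exact hj (if_neg h2)
  simpa using Finset.card_le_card h1

/-- The block structure of a weight matrix with respect to a subspace containing the column space of
`X`. When `X` has rank less than `r`, this subspace is larger than the column space. -/
lemma exists_isWeightBlock_of_rank_le {r : ℕ} (hr : 1 ≤ r) {X : Matrix (Fin n) (Fin n) ℝ}
    (hX : X.rank ≤ r) {W : Submodule ℝ (EuclideanSpace ℝ (Fin n))}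
    (hW : Module.finrank ℝ W = r) {w u : ℝ} (hw : w ∈ Set.Ioc (0 : ℝ) 1)
    (hu : u = largestPrincipalAngle (columnSpace X) W) :
    ∃ P S G a x, IsWeightBlock r (weightMatrix W w) P S G a x ∧ P * X = X ∧
      0 ≤ x ∧ x ≤ a ∧ a ≤ 1 ∧
      a = √((w ^ 4 * Real.cos u ^ 2 + Real.sin u ^ 2) / (w ^ 2 * Real.cos u ^ 2 + Real.sin u ^ 2)) ∧
      √2 * x = √(2 * (1 - w ^ 2) * Real.sin u ^ 2
        / (w ^ 2 * Real.cos u ^ 2 + Real.sin u ^ 2)) := by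
  obtain ⟨hw0, hw1⟩ := hw
  have hWbot : W ≠ ⊥ := by
    rintro rfl
    rw [finrank_bot] at hW
    omega
  have hfin : Module.finrank ℝ (columnSpace X) ≤ Module.finrank ℝ W := by
    rw [hW]
    rwa [rank_eq_finrank_range_toEuclideanLin] at hX
  have ht0 : 0 ≤ Real.sin u ^ 2 := sq_nonneg _
  have ht1 : Real.sin u ^ 2 ≤ 1 := Real.sin_sq_le_one u
  obtain ⟨U, hXU, hU, hUW⟩ := exists_le_finrank_eq_norm_starProjection_le hfin ht0 fun x hx => by
    rw [hu]
    exact norm_starProjection_orthogonal_sq_le hWbot hx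
  obtain ⟨S, G, h⟩ := exists_isWeightBlock (hU.trans hW) hW hw0 hw1 ht0 ht1 hUW
  have hD := weight_denominator_pos hw0 hw1 ht0
  have hw2 : w ^ 2 ≤ 1 := pow_le_one₀ hw0.le hw1
  have hw4 : w ^ 4 ≤ w ^ 2 := pow_le_pow_of_le_one hw0.le hw1 (by norm_num)
  refine ⟨projMatrix U, S, G, _, _, h, ?_, Real.sqrt_nonneg _, ?_, ?_, ?_, ?_⟩
  · refine ext_toEuclideanLin fun x => ?_
    rw [toEuclideanLin_mul_apply, toEuclideanLin_projMatrix]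
    exact Submodule.starProjection_eq_self_iff.2 (hXU ⟨x, rfl⟩)
  · refine Real.sqrt_le_sqrt (div_le_div_of_nonneg_right ?_ hD.le)
    have h1 : 0 ≤ w ^ 4 * (1 - Real.sin u ^ 2) := mul_nonneg (by positivity) (by linarith)
    have h2 : 0 ≤ w ^ 2 * Real.sin u ^ 2 := by positivity
    linarith
  · refine Real.sqrt_le_iff.2 ⟨zero_le_one, ?_⟩
    rw [one_pow, div_le_one hD]
    have := mul_le_mul_of_nonneg_right hw4 (sub_nonneg.2 ht1)
    linarith
  · rw [Real.cos_sq']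
  · rw [← Real.sqrt_mul zero_le_two, Real.cos_sq']
    congr 1
    ring

/-! ### Restricted isometry and the error bound -/

/-- The restricted isometry property applied to the head of the error from below, and to the blocks
of the tail from above. -/
lemma one_sub_mul_norm_head_le {m s : ℕ}
    {R : Matrix (Fin n) (Fin n) ℝ →ₗ[ℝ] EuclideanSpace ℝ (Fin m)}
    {δ : ℝ} (hR : RIP R s δ) {H : Matrix (Fin n) (Fin n) ℝ} {T : ℕ → Matrix (Fin n) (Fin n) ℝ}
    {N : ℕ} (hhead : (H - ∑ j ∈ Finset.range N, T j).rank ≤ s) (hT : ∀ j, (T j).rank ≤ s) :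
    (1 - δ) * ‖H - ∑ j ∈ Finset.range N, T j‖
      ≤ ‖R H‖ + (1 + δ) * ∑ j ∈ Finset.range N, ‖T j‖ := by
  obtain ⟨-, -, h⟩ := hR
  refine (h _ hhead).1.trans ?_
  rw [map_sub, map_sum, Finset.mul_sum]
  refine (norm_sub_le _ _).trans ?_
  gcongr
  exact (norm_sum_le _ _).trans (Finset.sum_le_sum fun j _ => (h _ (hT j)).2)

/-- The arithmetic that turns the cone condition and the restricted isometry property into an error
bound. Here `A` stands for `max α₁ α₂ / √30`, `k` for `√30`, `ρ` for `√r`, `N` for the nuclear norm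
of the error off the tangent space, `c` for the share of it that the tail feeds back, `F` for the
Frobenius norm of the head, `τ` for the sum of those of the tail blocks, and `μ` for the nuclear
norm of `M - Mr`. -/
lemma error_le_of_cone_of_rip {N F τ H μ e δ A ρ c k : ℝ} (hρ : 0 < ρ) (hF : 0 ≤ F) (hμ : 0 ≤ μ)
    (he : 0 ≤ e) (hA : 0 ≤ A) (hδ0 : 0 ≤ δ) (hδ1 : δ < 1) (hc : c ≤ 0.1)
    (hk : 5 ≤ k) (hbound : (1 + δ) * A ≤ 0.9 * (1 - δ))
    (hcone : N ≤ ρ * (1.1 * (1 - c) * (A * k)) * F + c * N + 2 * μ)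
    (hτ : τ ≤ N / (k * ρ)) (hrip : (1 - δ) * F ≤ 2 * e + (1 + δ) * τ) (hH : H ≤ F + τ) :
    H ≤ 401 / (1 - δ) * (μ / ρ + e) := by
  have hk0 : 0 < k := by linarith
  -- The cone condition, divided by `1 - c ≥ 0.9`.
  have hN : N ≤ 1.1 * (ρ * k * A * F) + 5 / 2 * μ := by
    by_contra! h1
    have h2 : 0 ≤ (0.1 - c) * (N - 1.1 * (ρ * k * A * F)) :=
      mul_nonneg (by linarith) (by linarith)
    linarith
  have hμρ : 0 ≤ μ / ρ := by positivity
  have hτ' : τ ≤ 1.1 * (A * F) + μ / ρ := by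
    refine hτ.trans ?_
    rw [div_le_iff₀ (by positivity)]
    have h1 : (1.1 * (A * F) + μ / ρ) * (k * ρ) = 1.1 * (ρ * k * A * F) + k * μ := by
      field_simp
    rw [h1]
    nlinarith
  have h1 : (1 + δ) * τ ≤ 0.99 * ((1 - δ) * F) + 2 * (μ / ρ) := by
    have h2 := mul_le_mul_of_nonneg_left hτ' (show 0 ≤ 1 + δ by linarith)
    have h3 := mul_le_mul_of_nonneg_right hbound hF
    nlinarith
  -- The tail is absorbed because `1.1 * 0.9 = 0.99 < 1`.
  have h2 : (1 - δ) * F ≤ 200 * (μ / ρ + e) := by linarith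
  have h3 : A ≤ 0.9 := by nlinarith
  have h4 : H ≤ 2 * F + μ / ρ := by nlinarith
  rw [div_mul_eq_mul_div, le_div_iff₀ (by linarith)]
  have h5 := mul_le_mul_of_nonneg_right h4 (show 0 ≤ 1 - δ by linarith)
  nlinarith [mul_nonneg hδ0 hμρ]

lemma one_add_mul_le_of_le_deltaBound {δ α : ℝ} (hα : 0 ≤ α) (h : δ ≤ deltaBound α) :
    (1 + δ) * (α / √30) ≤ 0.9 * (1 - δ) := by
  have h0 : 0 ≤ α / √30 := by positivity
  unfold deltaBound at h
  rw [le_div_iff₀ (by linarith)] at h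
  linarith

/-- The error bound with an explicit constant. -/
lemma norm_sub_le_of_isSolution {m r : ℕ} (hr : 1 ≤ r) {M Mr : Matrix (Fin n) (Fin n) ℝ}
    (hMr : IsRankTruncation r M Mr) {Ut Vt : Submodule ℝ (EuclideanSpace ℝ (Fin n))}
    (hUt : Module.finrank ℝ Ut = r) (hVt : Module.finrank ℝ Vt = r) {u v : ℝ}
    (hu : u = largestPrincipalAngle (columnSpace Mr) Ut)
    (hv : v = largestPrincipalAngle (rowSpace Mr) Vt) {lam rho : ℝ}
    (hlam : lam ∈ Set.Ioc (0 : ℝ) 1) (hrho : rho ∈ Set.Ioc (0 : ℝ) 1)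
    {R : Matrix (Fin n) (Fin n) ℝ →ₗ[ℝ] EuclideanSpace ℝ (Fin m)} {δ : ℝ}
    (hR : RIP R (32 * r) δ)
    (hδ : δ ≤ deltaBound (max (alpha1 lam rho u v) (alpha2 lam rho u v)))
    {E : Matrix (Fin n) (Fin n) ℝ} {e : ℝ} {y : EuclideanSpace ℝ (Fin m)}
    (hE : ‖R E‖ ≤ e) (hy : y = R (M + E)) {Mhat : Matrix (Fin n) (Fin n) ℝ}
    (hsol : IsSolution R y e Ut Vt lam rho Mhat) :
    ‖Mhat - M‖ ≤ 401 / (1 - δ) * (nuclearNorm (M - Mr) / √(r : ℝ) + e) := by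
  have hrank := rank_le_of_isRankTruncation hMr
  obtain ⟨P, S, G, a, x, hL, hPM, hx0, hxa, ha1, ha, hx⟩ :=
    exists_isWeightBlock_of_rank_le hr hrank hUt hlam hu
  obtain ⟨P', S', G', b, z, hL', hPM', hz0, hzb, hb1, hb, hz⟩ :=
    exists_isWeightBlock_of_rank_le hr (X := Mrᵀ) (by rwa [rank_transpose]) hVt hrho hv
  have hMP : Mr * P' = Mr := by
    have := congrArg transpose hPM'
    rwa [transpose_mul, transpose_transpose, hL'.transpose_proj] at this
  set α := max (alpha1 lam rho u v) (alpha2 lam rho u v) with hα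
  have hα1 : a + b ≤ α := by
    rw [ha, hb]
    exact le_max_left _ _
  have hα2 : √2 * (x + z) ≤ α := by
    rw [mul_add, hx, hz]
    exact le_max_right _ _
  have hα0 : 0 ≤ α := le_trans (by linarith) hα1
  set H := Mhat - M with hH
  -- Both `M` and `Mhat` are feasible.
  obtain ⟨hfeas, hmin⟩ := hsol
  have hMfeas : M ∈ feasibleSet R y e := by
    change ‖R M - y‖ ≤ e
    rw [hy, map_add, sub_add_cancel_left, norm_neg]
    exact hE
  have hRH : ‖R H‖ ≤ 2 * e := by
    have h1 : R H = (R Mhat - y) - (R M - y) := by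
      rw [hH, map_sub]
      abel
    rw [h1]
    have h2 : ‖R Mhat - y‖ ≤ e := hfeas
    have h3 : ‖R M - y‖ ≤ e := hMfeas
    linarith [norm_sub_le (R Mhat - y) (R M - y)]
  have hopt : nuclearNorm (weightMatrix Ut lam * (M + H) * weightMatrix Vt rho)
      ≤ nuclearNorm (weightMatrix Ut lam * M * weightMatrix Vt rho) := by
    rw [hH, add_sub_cancel]
    exact hmin hMfeas
  obtain ⟨T, N, hsplit, hTrank, hTsum, hTop, hTl, hTr⟩ :=
    exists_block_decomposition ((1 - P) * H * (1 - P')) (k := 30 * r) (by omega)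
  set tail := ∑ j ∈ Finset.range N, T (j + 1) with htail
  have hPtail : P * tail = 0 := by
    rw [htail, Finset.mul_sum]
    refine Finset.sum_eq_zero fun j _ => hTl P _ ?_
    rw [Matrix.mul_assoc, ← Matrix.mul_assoc P, Matrix.mul_sub, Matrix.mul_one, hL.proj_mul_self,
      sub_self, Matrix.zero_mul]
  have htailP : tail * P' = 0 := by
    rw [htail, Finset.sum_mul]
    refine Finset.sum_eq_zero fun j _ => hTr P' _ ?_
    have h1 : (1 - P') * P' = 0 := by
      rw [Matrix.sub_mul, Matrix.one_mul, hL'.proj_mul_self, sub_self]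
    rw [Matrix.mul_assoc, h1, Matrix.mul_zero]
  have hx1 : x ≤ 1 := hxa.trans ha1
  have hz1 : z ≤ 1 := hzb.trans hb1
  have hcone := nuclearNorm_offTangent_le_of_split hL hL' (hx0.trans hxa) hx0
    (pow_le_one₀ hx0 hx1) hPM hMP hopt hsplit hPtail htailP
  have hconst := mul_add_gap_le hx0 hz0 hxa hzb ha1 hb1 rfl hα1 hα2
  have hheadrank : (H - tail).rank ≤ 32 * r := by
    have h1 : H - tail = P * H + ((1 - P) * H * P' + T 0) := by
      have h2 : T 0 = (1 - P) * H * (1 - P') - tail := by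
        rw [hsplit, add_sub_cancel_right]
      rw [h2]
      noncomm_ring
    rw [h1]
    have h2 := rank_add_le_rank_add_rank (P * H) ((1 - P) * H * P' + T 0)
    have h3 := rank_add_le_rank_add_rank ((1 - P) * H * P') (T 0)
    have h4 := (rank_mul_le_left P H).trans hL.rank_proj_le
    have h5 := (rank_mul_le_right ((1 - P) * H) P').trans hL'.rank_proj_le
    have h6 := hTrank 0
    omega
  have hrip := one_sub_mul_norm_head_le hR hheadrank fun j => (hTrank (j + 1)).trans (by omega)
  have hr0 : (0 : ℝ) < r := by exact_mod_cast hr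
  set c := (x * z + x ^ 2 + z ^ 2) / 30 with hc
  have hc1 : c ≤ 0.1 := by
    have h1 : x * z ≤ 1 := mul_le_one₀ hx1 hz0 hz1
    have h2 : x ^ 2 ≤ 1 := pow_le_one₀ hx0 hx1
    have h3 : z ^ 2 ≤ 1 := pow_le_one₀ hz0 hz1
    rw [hc, div_le_iff₀ (by norm_num)]
    linarith
  have hsqrt : √((30 * r : ℕ) : ℝ) = √30 * √r := by
    push_cast
    exact Real.sqrt_mul (by norm_num) _
  refine error_le_of_cone_of_rip (k := √30) (A := α / √30) (c := c) (F := ‖H - tail‖)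
    (N := nuclearNorm ((1 - P) * H * (1 - P'))) (τ := ∑ j ∈ Finset.range N, ‖T (j + 1)‖)
    (Real.sqrt_pos.2 hr0) (norm_nonneg _) (nuclearNorm_nonneg _) ((norm_nonneg _).trans hE)
    (by positivity) hR.1 hR.2.1 hc1 (Real.le_sqrt_of_sq_le (by norm_num))
    (one_add_mul_le_of_le_deltaBound hα0 hδ) ?_ ?_ ?_ ?_
  · rw [div_mul_cancel₀ _ (by positivity)]
    have h1 : (r : ℝ) * (x * z + x ^ 2 + z ^ 2) * opNorm tail
        ≤ r * (x * z + x ^ 2 + z ^ 2)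
          * (nuclearNorm ((1 - P) * H * (1 - P')) / (30 * r : ℕ)) := by
      gcongr
    have h2 : (r : ℝ) * (x * z + x ^ 2 + z ^ 2)
        * (nuclearNorm ((1 - P) * H * (1 - P')) / (30 * r : ℕ))
        = c * nuclearNorm ((1 - P) * H * (1 - P')) := by
      rw [hc]
      push_cast
      field_simp
    have h3 := mul_le_mul_of_nonneg_left
      (mul_le_mul_of_nonneg_right hconst (norm_nonneg (H - tail))) (Real.sqrt_nonneg (r : ℝ))
    linarith
  · rwa [hsqrt] at hTsum
  · linarith
  · have h1 : H = (H - tail) + tail := (sub_add_cancel _ _).symm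
    have h2 := norm_add_le (H - tail) tail
    have h3 : ‖tail‖ ≤ ∑ j ∈ Finset.range N, ‖T (j + 1)‖ := norm_sum_le _ _
    rw [← h1] at h2
    linarith

end MatrixRecovery

end

theorem mainTheorem1 :
    ∃ C : ℝ, 0 < C ∧
      ∀ (n m r : ℕ), 1 ≤ r →
      ∀ (M Mr : Matrix (Fin n) (Fin n) ℝ), MatrixRecovery.IsRankTruncation r M Mr →
      ∀ (Ut Vt : Submodule ℝ (EuclideanSpace ℝ (Fin n))),
        Module.finrank ℝ Ut = r → Module.finrank ℝ Vt = r →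
      ∀ (u v : ℝ),
        u = MatrixRecovery.largestPrincipalAngle (MatrixRecovery.columnSpace Mr) Ut →
        v = MatrixRecovery.largestPrincipalAngle (MatrixRecovery.rowSpace Mr) Vt →
      ∀ (lam rho : ℝ), lam ∈ Set.Ioc (0 : ℝ) 1 → rho ∈ Set.Ioc (0 : ℝ) 1 →
      ∀ (R : Matrix (Fin n) (Fin n) ℝ →ₗ[ℝ] EuclideanSpace ℝ (Fin m)) (δ : ℝ),
        MatrixRecovery.RIP R (32 * r) δ →
        δ ≤ MatrixRecovery.deltaBound
          (max (MatrixRecovery.alpha1 lam rho u v) (MatrixRecovery.alpha2 lam rho u v)) →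
      ∀ (E : Matrix (Fin n) (Fin n) ℝ) (e : ℝ) (y : EuclideanSpace ℝ (Fin m)),
        ‖R E‖ ≤ e → y = R (M + E) →
      ∀ (Mhat : Matrix (Fin n) (Fin n) ℝ),
        MatrixRecovery.IsSolution R y e Ut Vt lam rho Mhat →
        ‖Mhat - M‖ ≤ C / (1 - δ) * (MatrixRecovery.nuclearNorm (M - Mr) / √(r : ℝ) + e) := by
  refine ⟨401, by norm_num, ?_⟩
  intro n m r hr M Mr hMr Ut Vt hUt hVt u v hu hv lam rho hlam hrho R δ hR hδ E e y hE hy Mhat hsol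
  exact MatrixRecovery.norm_sub_le_of_isSolution hr hMr hUt hVt hu hv hlam hrho hR hδ hE hy hsol
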